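/- For a group $G$, a model for $\underline EG$ is a $G$-CW-complex $X$ such that for every subgroup $K\le G$ the fixed point set $X^K$ is contractible if $K$ is finite and empty if $K$ is infinite; $\operatorname{gd}_{\mathfrak F}G\in\mathbb N\cup\{\infty\}$ denotes the minimal dimension of a model for $\underline EG$. Let $\Delta$ be a $G$-set such that, for every subgroup $H\le G$, $\Delta^H\ne\emptyset$ if and only if $H$ is finite. The $\mathfrak F$-cohomological dimension $\mathfrak F\operatorname{cd}G\in\mathbb N\cup\{\infty\}$ is the shortest length of a resolution of the trivial $\mathbb ZG$-module $\mathbb Z$ by direct summands of modules of the form $M\otimes\mathbb Z\Delta$ ($M$ a $\mathbb ZG$-module, diagonal action) that splits when restricted to every finite subgroup of $G$ (this does not depend on the choice of $\Delta$). Suppose that every group $G$ with $\mathfrak F\operatorname{cd}G<\infty$ admits a finite-dimensional model for $\underline EG$ (Nucinkis's conjecture). Then there exists a function $\phi:\mathbb N\to\mathbb N$ such that $\operatorname{gd}_{\mathfrak F}G\le\phi(\mathfrak F\operatorname{cd}G)$ for every group $G$ with $\mathfrak F\operatorname{cd}G<\infty$. -/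

import Mathlib

universe u

/-! ### Classifying spaces for proper actions -/

/-- `X`, with the given CW structure, is a `G`-CW-complex for the discrete group `G`: `X` is
Hausdorff, `G` acts by homeomorphisms that permute the open cells of each dimension, and an
element of `G` that maps an open cell to itself fixes that cell pointwise. -/
structure IsGCWComplex (G X : Type u) [Group G] [TopologicalSpace X] [MulAction G X]
    [Topology.CWComplex (Set.univ : Set X)] : Prop where
  t2 : T2Space X
  continuous_smul : ∀ g : G, Continuous fun x : X => g • x
  permutes : ∀ (g : G) (n : ℕ) (i : Topology.RelCWComplex.cell (Set.univ : Set X) n),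
    ∃ j : Topology.RelCWComplex.cell (Set.univ : Set X) n,
      (fun x : X => g • x) '' Topology.RelCWComplex.openCell n i
        = Topology.RelCWComplex.openCell n j
  admissible : ∀ (g : G) (n : ℕ) (i : Topology.RelCWComplex.cell (Set.univ : Set X) n),
    (fun x : X => g • x) '' Topology.RelCWComplex.openCell n i
        = Topology.RelCWComplex.openCell n i →
      ∀ x ∈ Topology.RelCWComplex.openCell n i, g • x = x

/-- `X` is a model for `E̲G`: a `G`-CW-complex in which `X ^ K` is contractible for every finite
subgroup `K` of `G` and empty for every other subgroup `K`. -/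
structure IsModelForProperActions (G X : Type u) [Group G] [TopologicalSpace X] [MulAction G X]
    [Topology.CWComplex (Set.univ : Set X)] : Prop extends IsGCWComplex G X where
  contractible : ∀ K : Subgroup G, Finite K → ContractibleSpace (MulAction.fixedPoints K X)
  empty : ∀ K : Subgroup G, ¬ Finite K → MulAction.fixedPoints K X = ∅

/-- `G` has a model for `E̲G` all of whose cells have dimension at most `n`. -/
def HasModelOfDimLE (G : Type u) [Group G] (n : ℕ) : Prop :=
  ∃ (X : Type u) (_ : TopologicalSpace X) (_ : MulAction G X)
    (_ : Topology.CWComplex (Set.univ : Set X)),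
    IsModelForProperActions G X ∧
      ∀ m : ℕ, n < m → IsEmpty (Topology.RelCWComplex.cell (Set.univ : Set X) m)

/-- `G` admits a finite-dimensional model for `E̲G`. -/
def AdmitsFiniteDimensionalModel (G : Type u) [Group G] : Prop :=
  ∃ (X : Type u) (_ : TopologicalSpace X) (_ : MulAction G X)
    (_ : Topology.CWComplex (Set.univ : Set X)),
    IsModelForProperActions G X ∧ Topology.RelCWComplex.FiniteDimensional (Set.univ : Set X)

/-- The Bredon geometric dimension: the minimal dimension of a model for `E̲G`
(`⊤` if there is no finite-dimensional model). -/
noncomputable def bredonGeometricDim (G : Type u) [Group G] : ℕ∞ :=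
  ⨅ (n : ℕ) (_ : HasModelOfDimLE G n), (n : ℕ∞)

/-! ### Cohomology relative to the finite subgroups -/

/-- The condition on the `G`-set `Δ` used to define cohomology relative to the finite subgroups:
a subgroup `H` of `G` has a fixed point in `Δ` if and only if `H` is finite. -/
def DetectsFiniteSubgroups (G Δ : Type u) [Group G] [MulAction G Δ] : Prop :=
  ∀ H : Subgroup G, (MulAction.fixedPoints H Δ).Nonempty ↔ Finite H

/-- The `ℤG`-module `P` (with action `ρ`) is a direct summand of `M ⊗ ℤΔ` (with diagonal action)
for some `ℤG`-module `M` (with action `σ`). -/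
def IsRelProjective {G : Type u} [Group G] (Δ : Type u) [MulAction G Δ]
    {P : Type u} [AddCommGroup P] (ρ : Representation ℤ G P) : Prop :=
  ∃ (M : Type u) (_ : AddCommGroup M) (σ : Representation ℤ G M)
    (i : ρ.IntertwiningMap (σ.tprod (Representation.ofMulAction ℤ G Δ)))
    (r : (σ.tprod (Representation.ofMulAction ℤ G Δ)).IntertwiningMap ρ),
    ∀ x, r (i x) = x

/-- A resolution `⋯ → P 1 → P 0 → ℤ → 0` of the trivial `ℤG`-module by direct summands of modules
`M ⊗ ℤΔ`, which splits on restriction to each finite subgroup `H`, that is, the augmented complex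
has a contracting homotopy `(s₀, s)` consisting of `ℤH`-module maps. -/
structure RelResolution (G Δ : Type u) [Group G] [MulAction G Δ] where
  P : ℕ → Type u
  [addCommGroup : ∀ n, AddCommGroup (P n)]
  ρ : ∀ n, Representation ℤ G (P n)
  d : ∀ n, (ρ (n + 1)).IntertwiningMap (ρ n)
  ε : (ρ 0).IntertwiningMap (Representation.trivial ℤ G ℤ)
  relProjective : ∀ n, IsRelProjective Δ (ρ n)
  surjective_ε : Function.Surjective ε
  exact_zero : Function.Exact (d 0) ε
  exact_succ : ∀ n, Function.Exact (d (n + 1)) (d n)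
  split : ∀ H : Subgroup G, Finite H →
    ∃ (s₀ : (Representation.trivial ℤ H ℤ).IntertwiningMap ((ρ 0).comp H.subtype))
      (s : ∀ n, Representation.IntertwiningMap
        ((ρ n).comp H.subtype) ((ρ (n + 1)).comp H.subtype)),
      (∀ k : ℤ, ε (s₀ k) = k) ∧
      (∀ x : P 0, d 0 (s 0 x) + s₀ (ε x) = x) ∧
      (∀ (n : ℕ) (x : P (n + 1)), d (n + 1) (s (n + 1) x) + s n (d n x) = x)

/-- For some `G`-set `Δ` that detects the finite subgroups there is a resolution as above of
length at most `n`. (The notion does not depend on the choice of `Δ`.) -/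
def HasRelResolutionOfLengthLE (G : Type u) [Group G] (n : ℕ) : Prop :=
  ∃ (Δ : Type u) (_ : MulAction G Δ), DetectsFiniteSubgroups G Δ ∧
    ∃ R : RelResolution G Δ, ∀ m : ℕ, n < m → Subsingleton (R.P m)

/-- The `𝔉`-cohomological dimension of `G`: the shortest length of a resolution as above
(`⊤` if there is none of finite length). -/
noncomputable def relCohomologicalDim (G : Type u) [Group G] : ℕ∞ :=
  ⨅ (n : ℕ) (_ : HasRelResolutionOfLengthLE G n), (n : ℕ∞)

/-! The argument is a diagonal one. If for some `n` there were no common bound, pick for every `k :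
ℕ` a group `H k` of relative dimension `n` with Bredon geometric dimension above `k`, and let `G` be
the free product of all `H k`. Its relative dimension is at most `n + 1`, so the conjecture provides
a model for `G` of some finite dimension `d`. Restricted to the factor `H d`, that model contradicts
the choice of `H d`.

The substance is the bound `n + 1`. `G` acts on a tree whose vertices are the cosets `g (H k)` and
the elements `g`, with an edge joining `g` to `g (H k)` for every `k`. Its chain complex `0 → Edges
→ Vertices → ℤ → 0` is exact, and it is split relative to the finite subgroups because each of these
fixes a 0-chain of augmentation one (`exists_relSplit_boundary`). `Vertices` is the module induced
from the trivial modules of the factors plus a free module, hence has dimension at most `n + 1`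
(`RelDimLE.ind`, `RelDimLE.prod`). `Edges` is free, so its inclusion lifts to the first term of a
resolution of `Vertices`, and passing to the cokernel `ℤ` only enlarges the first syzygy by `Edges`
(`RelDimLE.cokernel`).

For this bookkeeping, resolutions are replaced by the recursive `RelDimLE`, with splittings over
finite subgroups encoded as one equivariant family indexed by `Δ`, and with `FinSub G` as the
standard choice of `Δ`. -/

open scoped Pointwise

/-! ### Equivariant families -/

/-- Choosing values at orbit representatives yields an equivariant map out of a `G`-set `A` as
soon as the stabilizer of each point of `A` fixes an admissible value. -/
theorem exists_equivariant_map {G A B : Type*} [Group G] [MulAction G A] (act : G → B → B)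
    (act_mul : ∀ g h b, act (g * h) b = act g (act h b))
    (good : B → Prop) (good_act : ∀ g b, good b → good (act g b))
    (hfix : ∀ a : A, ∃ b, good b ∧ ∀ g : G, g • a = a → act g b = b) :
    ∃ f : A → B, (∀ a, good (f a)) ∧ ∀ (g : G) (a : A), f (g • a) = act g (f a) := by
  choose b hb hbfix using hfix
  let r : A → A := fun a => Quotient.out (Quotient.mk (MulAction.orbitRel G A) a)
  have hr : ∀ a, ∃ x : G, x • r a = a := fun a => by
    have h : (MulAction.orbitRel G A) (r a) a := Quotient.exact (Quotient.out_eq _)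
    obtain ⟨x, hx⟩ := (MulAction.orbitRel G A).symm h
    exact ⟨x, hx⟩
  have hrg : ∀ (g : G) a, r (g • a) = r a := fun g a => by
    have : Quotient.mk (MulAction.orbitRel G A) (g • a) = Quotient.mk _ a :=
      Quotient.sound ⟨g, rfl⟩
    simp only [r, this]
  choose x hx using hr
  refine ⟨fun a => act (x a) (b (r a)), fun a => good_act _ _ (hb _), fun g a => ?_⟩
  -- Two ways of reaching `g • a` from its orbit representative differ by a stabilizer element,
  -- which fixes the chosen value.
  have h1 : ((x (g • a))⁻¹ * (g * x a)) • r a = r a := by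
    rw [mul_smul, mul_smul, hx, inv_smul_eq_iff]
    conv_rhs => rw [← hrg g a, hx]
  have h2 := hbfix _ _ h1
  simp only [hrg]
  rw [← act_mul]
  conv_lhs => rw [← h2, ← act_mul]
  simp

/-! ### The set of nonempty finite subsets of a group -/

/-- The nonempty finite subsets of `G`. -/
def FinSub (G : Type u) : Type u := {S : Set G // S.Nonempty ∧ S.Finite}

namespace FinSub

variable {G : Type u} [Group G]

instance : MulAction G (FinSub G) where
  smul g S := ⟨g • S.1, S.2.1.smul_set, S.2.2.smul_set⟩
  one_smul S := Subtype.ext (one_smul G S.1)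
  mul_smul g h S := Subtype.ext (mul_smul g h S.1)

theorem coe_smul (g : G) (S : FinSub G) : (g • S).1 = g • S.1 := rfl

/-- The one-element subset `{g}`. -/
def single (g : G) : FinSub G := ⟨{g}, Set.singleton_nonempty g, Set.finite_singleton g⟩

theorem smul_single (g h : G) : g • single h = single (g * h) :=
  Subtype.ext (by rw [coe_smul]; simp [single])

/-- Left translation is free, so the orbit map of a point of `S` embeds `H` in `S`. -/
theorem finite_of_fixes (S : FinSub G) (H : Subgroup G) (h : ∀ x ∈ H, x • S = S) : Finite H := by
  obtain ⟨s, hs⟩ := S.2.1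
  have := S.2.2.to_subtype
  refine Finite.of_injective (β := S.1) (fun x : H => ⟨x.1 * s, ?_⟩) fun x y hxy => ?_
  · have h1 := congrArg Subtype.val (h x.1 x.2)
    rw [coe_smul] at h1
    have h2 := Set.smul_mem_smul_set (a := x.1) hs
    rw [h1] at h2
    exact h2
  · exact Subtype.ext (mul_right_cancel (congrArg Subtype.val hxy))

theorem finite_stabilizer (S : FinSub G) : Finite (MulAction.stabilizer G S) :=
  S.finite_of_fixes _ fun _ hx => hx

/-- A finite subgroup is itself a finite subset, invariant under its own translations. -/
theorem detectsFiniteSubgroups : DetectsFiniteSubgroups G (FinSub G) := by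
  refine fun H => ⟨fun ⟨S, hS⟩ => S.finite_of_fixes H fun x hx => hS ⟨x, hx⟩, fun hH => ?_⟩
  refine ⟨⟨(H : Set G), ⟨1, H.one_mem⟩, Set.toFinite _⟩, fun x => Subtype.ext ?_⟩
  exact smul_coe_set x.2

/-- The image of finite subsets under an injective homomorphism. -/
def map {H : Type u} [Group H] (φ : H →* G) (S : FinSub H) : FinSub G :=
  ⟨φ '' S.1, S.2.1.image _, S.2.2.image _⟩

theorem map_smul {H : Type u} [Group H] (φ : H →* G) (x : H) (S : FinSub H) :
    map φ (x • S) = φ x • map φ S :=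
  Subtype.ext (Set.image_smul_distrib φ x S.1)

end FinSub

/-- Maps of `G`-sets into a `G`-set that detects finite subgroups exist along homomorphisms. -/
theorem DetectsFiniteSubgroups.exists_equivariant {G A B : Type u} [Group G]
    [MulAction G A] [MulAction G B] (hB : DetectsFiniteSubgroups G B)
    (hA : ∀ a : A, Finite (MulAction.stabilizer G a)) :
    ∃ f : A → B, ∀ (g : G) (a : A), f (g • a) = g • f a := by
  obtain ⟨f, -, hf⟩ := exists_equivariant_map (G := G) (A := A) (B := B) (fun g b => g • b)
    mul_smul (fun _ => True) (fun _ _ _ => trivial) fun a => by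
      obtain ⟨b, hb⟩ := (hB (MulAction.stabilizer G a)).2 (hA a)
      exact ⟨b, trivial, fun g hg => hb ⟨g, hg⟩⟩
  exact ⟨f, hf⟩

theorem DetectsFiniteSubgroups.finite_stabilizer {G A : Type u} [Group G] [MulAction G A]
    (hA : DetectsFiniteSubgroups G A) (a : A) : Finite (MulAction.stabilizer G a) :=
  (hA _).1 ⟨a, fun g => g.2⟩

/-! ### Relative projectivity -/

/-- An action of `G` on `V` by additive maps. -/
abbrev AddRep (G V : Type*) [Monoid G] [AddCommGroup V] := G →* AddMonoid.End V

theorem AddRep.one_apply {G V : Type*} [Monoid G] [AddCommGroup V] (ρ : AddRep G V) (x : V) :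
    ρ 1 x = x := by rw [map_one]; rfl

theorem AddRep.mul_apply {G V : Type*} [Monoid G] [AddCommGroup V] (ρ : AddRep G V) (g h : G)
    (x : V) : ρ (g * h) x = ρ g (ρ h x) := by rw [map_mul]; rfl

/-- Additive maps are linear over the integers, for every module structure. -/
def AddMonoidHom.intLinear {M N : Type*} [AddCommGroup M] [AddCommGroup N] [Module ℤ M]
    [Module ℤ N] (f : M →+ N) : M →ₗ[ℤ] N :=
  { f with map_smul' := fun k x => by simpa using map_intCast_smul f ℤ ℤ k x }

/-- The representation over the integers given by an additive action. -/
def AddRep.toRepresentation {G V : Type*} [Monoid G] [AddCommGroup V] (ρ : AddRep G V) :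
    Representation ℤ G V where
  toFun g := (ρ g).intLinear
  map_one' := LinearMap.ext fun x => by rw [map_one]; rfl
  map_mul' g h := LinearMap.ext fun x => by rw [map_mul]; rfl

@[simp] theorem AddRep.toRepresentation_apply {G V : Type*} [Monoid G] [AddCommGroup V]
    (ρ : AddRep G V) (g : G) (x : V) : ρ.toRepresentation g x = ρ g x := rfl

/-- The additive action underlying a representation. -/
def Representation.toAddRep {G V : Type*} [Monoid G] [AddCommGroup V]
    (ρ : Representation ℤ G V) : AddRep G V where
  toFun g := (ρ g).toAddMonoidHom
  map_one' := AddMonoidHom.ext fun x => by rw [map_one]; rfl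
  map_mul' g h := AddMonoidHom.ext fun x => by rw [map_mul]; rfl

@[simp] theorem Representation.toAddRep_apply {G V : Type*} [Monoid G] [AddCommGroup V]
    (ρ : Representation ℤ G V) (g : G) (x : V) : ρ.toAddRep g x = ρ g x := rfl

/-- The product of two additive actions. -/
def AddRep.prod {G V W : Type*} [Monoid G] [AddCommGroup V] [AddCommGroup W] (ρ : AddRep G V)
    (σ : AddRep G W) : AddRep G (V × W) where
  toFun g := (ρ g).prodMap (σ g)
  map_one' := AddMonoidHom.ext fun x => by rw [map_one, map_one]; rfl
  map_mul' g h := AddMonoidHom.ext fun x => by rw [map_mul, map_mul]; rfl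

@[simp] theorem AddRep.prod_apply {G V W : Type*} [Monoid G] [AddCommGroup V] [AddCommGroup W]
    (ρ : AddRep G V) (σ : AddRep G W) (g : G) (x : V × W) :
    ρ.prod σ g x = (ρ g x.1, σ g x.2) := rfl

section RelProj

variable {G : Type u} [Group G] {P Q : Type u} [AddCommGroup P] [AddCommGroup Q]

/-- The diagonal action on finitely supported functions `Δ → P`. -/
noncomputable def twist (Δ : Type u) [MulAction G Δ] (ρ : AddRep G P) (g : G) :
    (Δ →₀ P) →+ (Δ →₀ P) :=
  Finsupp.liftAddHom fun δ => (Finsupp.singleAddHom (g • δ)).comp (ρ g)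

@[simp] theorem twist_single (Δ : Type u) [MulAction G Δ] (ρ : AddRep G P) (g : G)
    (δ : Δ) (x : P) : twist Δ ρ g (Finsupp.single δ x) = Finsupp.single (g • δ) (ρ g x) := by
  rw [twist, Finsupp.liftAddHom_apply_single]; rfl

/-- The sum of the values of a finitely supported function. -/
noncomputable def total (Δ : Type u) (P : Type u) [AddCommGroup P] : (Δ →₀ P) →+ P :=
  Finsupp.liftAddHom fun _ => AddMonoidHom.id P

@[simp] theorem total_single (Δ : Type u) (δ : Δ) (x : P) :
    total Δ P (Finsupp.single δ x) = x := by
  simp [total]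

/-- `P` is relatively projective: the summation map `P ⊗ ℤΔ → P` splits equivariantly. -/
def RelProj (Δ : Type u) [MulAction G Δ] (ρ : AddRep G P) : Prop :=
  ∃ π : P →+ (Δ →₀ P), (∀ g x, π (ρ g x) = twist Δ ρ g (π x)) ∧ ∀ x, total Δ P (π x) = x

/-- Additive maps out of `M ⊗ ℤΔ` agree if they agree on the elements `m ⊗ kδ`. -/
theorem tensor_monoidAlgebra_ext {M N Δ : Type*} [AddCommGroup M] [AddCommGroup N]
    {a b : TensorProduct ℤ M (MonoidAlgebra ℤ Δ) →+ N}
    (hab : ∀ m δ k, a (m ⊗ₜ MonoidAlgebra.single δ k) = b (m ⊗ₜ MonoidAlgebra.single δ k)) :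
    a = b := by
  refine AddMonoidHom.ext fun z => ?_
  induction z using TensorProduct.induction_on with
  | zero => rw [map_zero, map_zero]
  | add y z hy hz => rw [map_add, map_add, hy, hz]
  | tmul x f => ?_
  induction f using MonoidAlgebra.induction_linear with
  | zero => rw [TensorProduct.tmul_zero, map_zero, map_zero]
  | add f g hf hg => rw [TensorProduct.tmul_add, map_add, map_add, hf, hg]
  | single δ k => exact hab x δ k

/-- Take `M = P`: under `P ⊗ ℤΔ ≅ (Δ →₀ P)`, the section of the summation map exhibits `P` as a
summand. -/
theorem RelProj.isRelProjective {Δ : Type u} [MulAction G Δ] {ρ : AddRep G P}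
    (h : RelProj Δ ρ) : IsRelProjective Δ ρ.toRepresentation := by
  classical
  obtain ⟨π, hπ, hs⟩ := h
  let j : (Δ →₀ P) →+ TensorProduct ℤ P (MonoidAlgebra ℤ Δ) :=
    Finsupp.liftAddHom fun δ => ((TensorProduct.mk ℤ P (MonoidAlgebra ℤ Δ)).flip
      (MonoidAlgebra.single δ 1)).toAddMonoidHom
  let q : TensorProduct ℤ P (MonoidAlgebra ℤ Δ) →+ P :=
    (total Δ P).comp ((TensorProduct.finsuppScalarRight ℤ ℤ P Δ).toAddMonoidHom.comp
      ((MonoidAlgebra.coeffLinearEquiv ℤ).toLinearMap.lTensor P).toAddMonoidHom)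
  have hj0 : ∀ δ x, j (Finsupp.single δ x) = x ⊗ₜ MonoidAlgebra.single δ 1 := fun δ x => by
    simp [j]
  have hq : ∀ (x : P) (δ : Δ) (k : ℤ), q (x ⊗ₜ MonoidAlgebra.single δ k) = k • x := by
    intro x δ k
    change total Δ P (TensorProduct.finsuppScalarRight ℤ ℤ P Δ (x ⊗ₜ Finsupp.single δ k)) = _
    rw [TensorProduct.finsuppScalarRight_apply_tmul, Finsupp.sum_single_index (by simp),
      total_single]
  have hj : ∀ g, j.comp (twist Δ ρ g) =
      ((ρ.toRepresentation.tprod (Representation.ofMulAction ℤ G Δ)) g).toAddMonoidHom.comp j := by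
    intro g
    refine Finsupp.addHom_ext fun δ x => ?_
    simp only [AddMonoidHom.comp_apply, twist_single, hj0, Representation.tprod_apply,
      LinearMap.toAddMonoidHom_coe, TensorProduct.map_tmul, Representation.ofMulAction_single,
      AddRep.toRepresentation_apply]
  refine ⟨P, inferInstance, ρ.toRepresentation, ⟨(j.comp π).intLinear, fun g => ?_⟩,
    ⟨q.intLinear, fun g => ?_⟩, fun x => ?_⟩
  · refine LinearMap.ext fun x => ?_
    change j (π (ρ g x)) = _
    rw [hπ]
    exact DFunLike.congr_fun (hj g) (π x)
  · refine LinearMap.toAddMonoidHom_injective (tensor_monoidAlgebra_ext fun x δ k => ?_)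
    change q ((ρ.toRepresentation.tprod (Representation.ofMulAction ℤ G Δ)) g
      (x ⊗ₜ MonoidAlgebra.single δ k)) = ρ g (q (x ⊗ₜ MonoidAlgebra.single δ k))
    rw [Representation.tprod_apply, TensorProduct.map_tmul, Representation.ofMulAction_single, hq,
      hq, map_zsmul, AddRep.toRepresentation_apply]
  · have : q.comp j = total Δ P := Finsupp.addHom_ext fun δ x => by
      rw [AddMonoidHom.comp_apply, hj0, hq, one_smul, total_single]
    exact (DFunLike.congr_fun this (π x)).trans (hs x)

/-- The module `M ⊗ ℤΔ` has a tautological section, placing `m ⊗ δ` over `δ`; composing with the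
inclusion and retraction of `P` gives one for `P`. -/
theorem IsRelProjective.relProj {Δ : Type u} [MulAction G Δ] {ρ : Representation ℤ G P}
    (h : IsRelProjective Δ ρ) : RelProj Δ ρ.toAddRep := by
  classical
  obtain ⟨M, _, σ, i, r, hri⟩ := h
  let θ : TensorProduct ℤ M (MonoidAlgebra ℤ Δ) →+ (Δ →₀ P) :=
    (Finsupp.liftAddHom fun δ => (Finsupp.singleAddHom δ).comp (r.toLinearMap.toAddMonoidHom.comp
      ((TensorProduct.mk ℤ M (MonoidAlgebra ℤ Δ)).flip
        (MonoidAlgebra.single δ 1)).toAddMonoidHom)).comp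
    ((TensorProduct.finsuppScalarRight ℤ ℤ M Δ).toAddMonoidHom.comp
      ((MonoidAlgebra.coeffLinearEquiv ℤ).toLinearMap.lTensor M).toAddMonoidHom)
  have hsmul : ∀ (m : M) (δ : Δ) (k : ℤ),
      (k • m) ⊗ₜ[ℤ] MonoidAlgebra.single δ (1 : ℤ) = m ⊗ₜ MonoidAlgebra.single δ k := by
    intro m δ k
    rw [TensorProduct.smul_tmul, MonoidAlgebra.smul_single, smul_eq_mul, mul_one]
  have hθ : ∀ (m : M) (δ : Δ) (k : ℤ), θ (m ⊗ₜ MonoidAlgebra.single δ k) =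
      Finsupp.single δ (r (m ⊗ₜ MonoidAlgebra.single δ k)) := by
    intro m δ k
    change Finsupp.liftAddHom _
      (TensorProduct.finsuppScalarRight ℤ ℤ M Δ (m ⊗ₜ Finsupp.single δ k)) = _
    rw [TensorProduct.finsuppScalarRight_apply_tmul, Finsupp.sum_single_index (by simp),
      Finsupp.liftAddHom_apply_single]
    change Finsupp.single δ (r ((k • m) ⊗ₜ[ℤ] MonoidAlgebra.single δ (1 : ℤ))) = _
    rw [hsmul]
  have hequiv : ∀ g, θ.comp ((σ.tprod (Representation.ofMulAction ℤ G Δ)) g).toAddMonoidHom =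
      (twist Δ ρ.toAddRep g).comp θ := by
    intro g
    refine tensor_monoidAlgebra_ext fun m δ k => ?_
    have := r.isIntertwining _ _ g (m ⊗ₜ MonoidAlgebra.single δ k)
    rw [Representation.tprod_apply, TensorProduct.map_tmul,
        Representation.ofMulAction_single] at this
    simp only [Representation.tprod_apply, AddMonoidHom.comp_apply, LinearMap.toAddMonoidHom_coe,
      TensorProduct.map_tmul, Representation.ofMulAction_single, hθ, twist_single, this,
      Representation.toAddRep_apply]
  refine ⟨θ.comp i.toLinearMap.toAddMonoidHom, fun g x => ?_, fun x => ?_⟩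
  · change θ (i (ρ g x)) = _
    rw [i.isIntertwining]
    exact DFunLike.congr_fun (hequiv g) (i x)
  · have : (total Δ P).comp θ = r.toLinearMap.toAddMonoidHom :=
      tensor_monoidAlgebra_ext fun m δ k => by
        rw [AddMonoidHom.comp_apply, hθ, total_single]; rfl
    exact (DFunLike.congr_fun this (i x)).trans (hri x)

/-- Relative projectivity passes to retracts, and along maps of the coefficient sets. -/
theorem RelProj.map {Δ Δ' : Type u} [MulAction G Δ] [MulAction G Δ'] {ρ : AddRep G P}
    {σ : AddRep G Q} (h : RelProj Δ ρ) (f : Δ → Δ') (hf : ∀ (g : G) δ, f (g • δ) = g • f δ)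
    (a : Q →+ P) (ha : ∀ g x, a (σ g x) = ρ g (a x)) (b : P →+ Q)
    (hb : ∀ g x, b (ρ g x) = σ g (b x)) (hba : ∀ x, b (a x) = x) : RelProj Δ' σ := by
  obtain ⟨π, hπ, hs⟩ := h
  let F : (Δ →₀ P) →+ (Δ' →₀ Q) :=
    Finsupp.liftAddHom fun δ => (Finsupp.singleAddHom (f δ)).comp b
  have hF : ∀ g, F.comp (twist Δ ρ g) = (twist Δ' σ g).comp F := fun g =>
    Finsupp.addHom_ext fun δ x => by simp [F, hf, hb]
  have hF' : (total Δ' Q).comp F = b.comp (total Δ P) :=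
    Finsupp.addHom_ext fun δ x => by simp [F]
  refine ⟨F.comp (π.comp a), fun g x => ?_, fun x => ?_⟩
  · change F (π (a (σ g x))) = _
    rw [ha, hπ]
    exact DFunLike.congr_fun (hF g) _
  · refine (DFunLike.congr_fun hF' (π (a x))).trans ?_
    rw [AddMonoidHom.comp_apply, hs, hba]

theorem RelProj.prod {Δ : Type u} [MulAction G Δ] {ρ : AddRep G P}
    {σ : AddRep G Q} (hρ : RelProj Δ ρ) (hσ : RelProj Δ σ) : RelProj Δ (ρ.prod σ) := by
  obtain ⟨π, hπ, hs⟩ := hρ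
  obtain ⟨π', hπ', hs'⟩ := hσ
  let F : (Δ →₀ P) →+ (Δ →₀ P × Q) :=
    Finsupp.liftAddHom fun δ => (Finsupp.singleAddHom δ).comp (AddMonoidHom.inl P Q)
  let F' : (Δ →₀ Q) →+ (Δ →₀ P × Q) :=
    Finsupp.liftAddHom fun δ => (Finsupp.singleAddHom δ).comp (AddMonoidHom.inr P Q)
  have hF : ∀ g, F.comp (twist Δ ρ g) = (twist Δ (ρ.prod σ) g).comp F := fun g =>
    Finsupp.addHom_ext fun δ x => by simp [F]
  have hF' : ∀ g, F'.comp (twist Δ σ g) = (twist Δ (ρ.prod σ) g).comp F' := fun g =>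
    Finsupp.addHom_ext fun δ x => by simp [F']
  have hF1 : (total Δ (P × Q)).comp F = (AddMonoidHom.inl P Q).comp (total Δ P) :=
    Finsupp.addHom_ext fun δ x => by simp [F]
  have hF1' : (total Δ (P × Q)).comp F' = (AddMonoidHom.inr P Q).comp (total Δ Q) :=
    Finsupp.addHom_ext fun δ x => by simp [F']
  refine ⟨(F.comp π).coprod (F'.comp π'), fun g x => ?_, fun x => ?_⟩
  · change F (π (ρ g x.1)) + F' (π' (σ g x.2)) = twist Δ (ρ.prod σ) g (F (π x.1) + F' (π' x.2))
    rw [hπ, hπ', map_add]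
    exact congrArg₂ _ (DFunLike.congr_fun (hF g) _) (DFunLike.congr_fun (hF' g) _)
  · change total Δ (P × Q) (F (π x.1) + F' (π' x.2)) = x
    rw [map_add]
    refine (congrArg₂ (· + ·) (DFunLike.congr_fun hF1 _) (DFunLike.congr_fun hF1' _)).trans ?_
    simp [hs, hs']

end RelProj

/-! ### Relatively split extensions and relative dimension -/

section RelSplit

variable {G : Type u} [Group G]

/-- A short exact sequence `K → P → V` of `G`-modules together with a `Δ`-indexed equivariant
family of additive splittings. -/
structure RelSplit (Δ : Type u) [MulAction G Δ] {K P V : Type u} [AddCommGroup K]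
    [AddCommGroup P] [AddCommGroup V] (κ : AddRep G K) (π : AddRep G P) (ρ : AddRep G V) where
  i : K →+ P
  p : P →+ V
  t : Δ → V →+ P
  u : Δ → P →+ K
  i_equiv : ∀ g x, i (κ g x) = π g (i x)
  p_equiv : ∀ g x, p (π g x) = ρ g (p x)
  t_equiv : ∀ g δ x, t (g • δ) (ρ g x) = π g (t δ x)
  u_equiv : ∀ g δ x, u (g • δ) (π g x) = κ g (u δ x)
  p_i : ∀ x, p (i x) = 0
  u_i : ∀ δ x, u δ (i x) = x
  p_t : ∀ δ x, p (t δ x) = x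
  add : ∀ δ x, i (u δ x) + t δ (p x) = x

variable {Δ : Type u} [MulAction G Δ] {K P V W E : Type u} [AddCommGroup K] [AddCommGroup P]
  [AddCommGroup V] [AddCommGroup W] [AddCommGroup E] {κ : AddRep G K}
  {π : AddRep G P} {ρ : AddRep G V} {τ : AddRep G W} {η : AddRep G E}

/-- The retraction `u δ` is forced by `i (u δ x) = x - t δ (p x)`; its additivity and equivariance
follow from injectivity of `i`. -/
theorem RelSplit.of_exact (i : K →+ P) (p : P →+ V) (t : Δ → V →+ P)
    (i_equiv : ∀ g x, i (κ g x) = π g (i x)) (p_equiv : ∀ g x, p (π g x) = ρ g (p x))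
    (t_equiv : ∀ g δ x, t (g • δ) (ρ g x) = π g (t δ x)) (hi : Function.Injective i)
    (p_i : ∀ x, p (i x) = 0) (hex : ∀ x, p x = 0 → ∃ y, i y = x) (p_t : ∀ δ x, p (t δ x) = x) :
    ∃ S : RelSplit Δ κ π ρ, S.i = i ∧ S.p = p ∧ S.t = t := by
  have h : ∀ δ x, ∃ y, i y = x - t δ (p x) := fun δ x => hex _ (by rw [map_sub, p_t, sub_self])
  choose u hu using h
  refine ⟨⟨i, p, t, fun δ => AddMonoidHom.mk' (u δ) fun x y => hi ?_, i_equiv, p_equiv, t_equiv,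
    fun g δ x => hi ?_, p_i, fun δ x => hi ?_, p_t, fun δ x => ?_⟩, rfl, rfl, rfl⟩
  · rw [map_add, hu, hu, hu, map_add, map_add]; abel
  · rw [AddMonoidHom.mk'_apply, AddMonoidHom.mk'_apply, hu, i_equiv, hu, map_sub, p_equiv, t_equiv]
  · rw [AddMonoidHom.mk'_apply, hu, p_i, map_zero, sub_zero]
  · rw [AddMonoidHom.mk'_apply, hu, sub_add_cancel]

/-- `V` has relative dimension at most `n`. -/
def RelDimLE (Δ : Type u) [MulAction G Δ] :
    ℕ → ∀ (V : Type u) [AddCommGroup V], AddRep G V → Prop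
  | 0, _, _, ρ => RelProj Δ ρ
  | n + 1, _, _, ρ => ∃ (K P : Type u) (_ : AddCommGroup K) (_ : AddCommGroup P)
      (κ : AddRep G K) (π : AddRep G P),
      RelProj Δ π ∧ Nonempty (RelSplit Δ κ π ρ) ∧ RelDimLE Δ n K κ

/-- The extra summand `E` is absorbed by the first projective, so the syzygy does not change. -/
theorem RelDimLE.prod {n : ℕ} (h : RelDimLE Δ n V ρ) (hE : RelProj Δ η) :
    RelDimLE Δ n (V × E) (ρ.prod η) := by
  cases n with
  | zero => exact RelProj.prod h hE
  | succ n =>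
    obtain ⟨K, P, _, _, κ, π, hP, ⟨S⟩, hK⟩ := h
    refine ⟨K, P × E, inferInstance, inferInstance, κ, π.prod η, hP.prod hE, ⟨?_⟩, hK⟩
    exact
      { i := (AddMonoidHom.inl P E).comp S.i
        p := S.p.prodMap (AddMonoidHom.id E)
        t := fun δ => (S.t δ).prodMap (AddMonoidHom.id E)
        u := fun δ => (S.u δ).comp (AddMonoidHom.fst P E)
        i_equiv := fun g x => by simp [S.i_equiv]
        p_equiv := fun g x => by simp [S.p_equiv]
        t_equiv := fun g δ x => by simp [S.t_equiv]
        u_equiv := fun g δ x => by simp [S.u_equiv]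
        p_i := fun x => by simp [S.p_i]
        u_i := fun δ x => by simp [S.u_i]
        p_t := fun δ x => Prod.ext (S.p_t δ x.1) rfl
        add := fun δ x => by ext <;> simp [S.add] }

/-- If `0 → E → V → W → 0` is relatively split with `E` relatively projective, then `W` has
relative dimension at most that of `V`, if the latter is positive and `E → V` lifts through
relatively split surjections. -/
theorem RelDimLE.cokernel {n : ℕ} (h : RelDimLE Δ (n + 1) V ρ) (hE : RelProj Δ η)
    (T : RelSplit Δ η ρ τ)
    (lift : ∀ (P : Type u) [AddCommGroup P] (π : AddRep G P) (p : P →+ V),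
      Function.Surjective p → (∀ g x, p (π g x) = ρ g (p x)) →
      ∃ l : E →+ P, (∀ g x, l (η g x) = π g (l x)) ∧ ∀ x, p (l x) = T.i x) [Nonempty Δ] :
    RelDimLE Δ (n + 1) W τ := by
  obtain ⟨K, P, _, _, κ, π, hP, ⟨S⟩, hK⟩ := h
  obtain ⟨l, hl, hpl⟩ := lift P π S.p
    (fun x => ⟨S.t (Classical.arbitrary Δ) x, S.p_t _ x⟩) S.p_equiv
  -- The kernel of `P → V → W` is an extension of `E` by `K`, and the lift `l` splits it. Only a
  -- syzygy grows, hence the need for positive dimension.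
  refine ⟨K × E, P, inferInstance, inferInstance, κ.prod η, π, hP, ?_, hK.prod hE⟩
  obtain ⟨R, -⟩ := RelSplit.of_exact (κ := κ.prod η) (π := π) (ρ := τ) (S.i.coprod l)
    (T.p.comp S.p) (fun δ => (S.t δ).comp (T.t δ))
    (fun g x => by simp [S.i_equiv, hl]) (fun g x => by simp [S.p_equiv, T.p_equiv])
    (fun g δ x => by simp [S.t_equiv, T.t_equiv])
    (by
      rw [injective_iff_map_eq_zero]
      rintro ⟨x, e⟩ hx
      let δ := Classical.arbitrary Δ
      rw [AddMonoidHom.coprod_apply] at hx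
      have he : e = 0 := by
        have h1 := congrArg (fun y => T.u δ (S.p y)) hx
        simpa [S.p_i, hpl, T.u_i] using h1
      subst he
      have h2 := congrArg (S.u δ) hx
      simpa [S.u_i] using h2)
    (fun x => by simp [S.p_i, hpl, T.p_i])
    (fun x hx => by
      let δ := Classical.arbitrary Δ
      refine ⟨(S.u δ (x - l (T.u δ (S.p x))), T.u δ (S.p x)), ?_⟩
      have h1 := S.add δ (x - l (T.u δ (S.p x)))
      have h2 := T.add δ (S.p x)
      have h3 : T.p (S.p x) = 0 := hx
      rw [h3, map_zero, add_zero] at h2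
      rw [map_sub S.p, hpl, h2, sub_self, map_zero, add_zero] at h1
      rw [AddMonoidHom.coprod_apply, h1, sub_add_cancel])
    (fun δ x => by simp [S.p_t, T.p_t])
  exact ⟨R⟩

end RelSplit

/-! ### Induction from a family of subgroups -/

section Cocycle

variable {H G : Type*} [Group H] [Group G] (φ : H →* G)

theorem exists_cosetCocycle (g : G) (c : G ⧸ φ.range) :
    ∃ x : H, φ x = (Quotient.out (g • c))⁻¹ * (g * Quotient.out c) := by
  have h : (QuotientGroup.mk (Quotient.out (g • c)) : G ⧸ φ.range) =
      QuotientGroup.mk (g * Quotient.out c) :=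
    (QuotientGroup.out_eq' (g • c)).trans (congrArg (g • ·) (QuotientGroup.out_eq' c).symm)
  exact QuotientGroup.eq.1 h

/-- The cocycle on `G / H` with values in `H` given by a system of coset representatives. -/
noncomputable def cosetCocycle (g : G) (c : G ⧸ φ.range) : H := (exists_cosetCocycle φ g c).choose

theorem map_cosetCocycle (g : G) (c : G ⧸ φ.range) :
    φ (cosetCocycle φ g c) = (Quotient.out (g • c))⁻¹ * (g * Quotient.out c) :=
  (exists_cosetCocycle φ g c).choose_spec

theorem out_mul_cosetCocycle (g : G) (c : G ⧸ φ.range) :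
    Quotient.out (g • c) * φ (cosetCocycle φ g c) = g * Quotient.out c := by
  rw [map_cosetCocycle, mul_inv_cancel_left]

variable {φ}

theorem cosetCocycle_one (hφ : Function.Injective φ) (c : G ⧸ φ.range) : cosetCocycle φ 1 c = 1 := hφ <| by
  rw [map_cosetCocycle, one_smul, one_mul, inv_mul_cancel, map_one]

theorem cosetCocycle_mul (hφ : Function.Injective φ) (g h : G) (c : G ⧸ φ.range) :
    cosetCocycle φ (g * h) c = cosetCocycle φ g (h • c) * cosetCocycle φ h c := hφ <| by
  rw [map_mul, map_cosetCocycle, map_cosetCocycle, map_cosetCocycle, mul_smul]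
  group

end Cocycle

section Induction

open scoped DirectSum Classical

variable {ι : Type} {H : ι → Type u} [∀ k, Group (H k)] {G : Type u} [Group G]
  (φ : ∀ k, H k →* G)

/-- The underlying group of the module induced from the family of `H k`-modules `V k`. -/
abbrev Ind (V : ι → Type u) [∀ k, AddCommGroup (V k)] : Type u :=
  ⨁ c : (Σ k, G ⧸ (φ k).range), V c.1

variable {φ} {U V W : ι → Type u} [∀ k, AddCommGroup (U k)] [∀ k, AddCommGroup (V k)]
  [∀ k, AddCommGroup (W k)]

/-- The inclusion of the summand belonging to a coset. -/
noncomputable def Ind.of (k : ι) (c : G ⧸ (φ k).range) : V k →+ Ind φ V :=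
  DirectSum.of (fun c : (Σ k, G ⧸ (φ k).range) => V c.1) ⟨k, c⟩

/-- The additive map on an induced module with given restrictions to the summands. -/
noncomputable def Ind.lift {A : Type*} [AddCommGroup A]
    (f : ∀ k, G ⧸ (φ k).range → V k →+ A) : Ind φ V →+ A :=
  DirectSum.toAddMonoid fun c => f c.1 c.2

@[simp] theorem Ind.lift_of {A : Type*} [AddCommGroup A]
    (f : ∀ k, G ⧸ (φ k).range → V k →+ A) (k : ι) (c : G ⧸ (φ k).range) (x : V k) :
    Ind.lift f (Ind.of k c x) = f k c x :=
  DirectSum.toAddMonoid_of (fun c : (Σ k, G ⧸ (φ k).range) => f c.1 c.2) ⟨k, c⟩ x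

theorem Ind.hom_ext {A : Type*} [AddCommGroup A] {a b : Ind φ V →+ A}
    (h : ∀ k c x, a (Ind.of k c x) = b (Ind.of k c x)) : a = b :=
  DirectSum.addHom_ext fun c x => h c.1 c.2 x

theorem Ind.apply_ext {A : Type*} [AddCommGroup A] (a b : Ind φ V →+ A)
    (h : ∀ k c x, a (Ind.of k c x) = b (Ind.of k c x)) (y : Ind φ V) : a y = b y :=
  DFunLike.congr_fun (Ind.hom_ext h) y

/-- The action on an induced module. -/
noncomputable def Ind.rep (hφ : ∀ k, Function.Injective (φ k)) (ρ : ∀ k, AddRep (H k) (V k)) :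
    AddRep G (Ind φ V) where
  toFun g := Ind.lift fun k c => (Ind.of k (g • c)).comp (ρ k (cosetCocycle (φ k) g c))
  map_one' := Ind.hom_ext fun k c x => by
    rw [Ind.lift_of, cosetCocycle_one (hφ k), one_smul]
    change Ind.of k c (ρ k 1 x) = _
    rw [AddRep.one_apply]
    rfl
  map_mul' g h := Ind.hom_ext fun k c x => by
    rw [Ind.lift_of, cosetCocycle_mul (hφ k), mul_smul]
    change Ind.of k _ (ρ k (_ * _) x) = _
    rw [AddRep.mul_apply]
    change _ = Ind.lift (fun k c => (Ind.of k (g • c)).comp (ρ k (cosetCocycle (φ k) g c)))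
      (Ind.lift (fun k c => (Ind.of k (h • c)).comp (ρ k (cosetCocycle (φ k) h c)))
        (Ind.of k c x))
    rw [Ind.lift_of]
    exact (Ind.lift_of (fun k c => (Ind.of k (g • c)).comp (ρ k (cosetCocycle (φ k) g c))) k
      (h • c) (ρ k (cosetCocycle (φ k) h c) x)).symm

@[simp] theorem Ind.rep_of (hφ : ∀ k, Function.Injective (φ k)) (ρ : ∀ k, AddRep (H k) (V k))
    (g : G) (k : ι) (c : G ⧸ (φ k).range) (x : V k) :
    Ind.rep hφ ρ g (Ind.of k c x) = Ind.of k (g • c) (ρ k (cosetCocycle (φ k) g c) x) :=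
  Ind.lift_of _ k c x

/-- The additive map of induced modules given by a family of additive maps. -/
noncomputable def Ind.map (f : ∀ k, G ⧸ (φ k).range → U k →+ V k) : Ind φ U →+ Ind φ V :=
  Ind.lift fun k c => (Ind.of k c).comp (f k c)

@[simp] theorem Ind.map_of (f : ∀ k, G ⧸ (φ k).range → U k →+ V k) (k : ι) (c : G ⧸ (φ k).range)
    (x : U k) : Ind.map f (Ind.of k c x) = Ind.of k c (f k c x) :=
  Ind.lift_of _ k c x

theorem Ind.map_equiv (hφ : ∀ k, Function.Injective (φ k)) {ρ : ∀ k, AddRep (H k) (U k)}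
    {σ : ∀ k, AddRep (H k) (V k)} {f f' : ∀ k, G ⧸ (φ k).range → U k →+ V k} (g : G)
    (h : ∀ k c x, f' k (g • c) (ρ k (cosetCocycle (φ k) g c) x) =
      σ k (cosetCocycle (φ k) g c) (f k c x)) (y : Ind φ U) :
    Ind.map f' (Ind.rep hφ ρ g y) = Ind.rep hφ σ g (Ind.map f y) :=
  Ind.apply_ext ((Ind.map f').comp (Ind.rep hφ ρ g)) ((Ind.rep hφ σ g).comp (Ind.map f))
    (fun k c x => by
      change Ind.map f' (Ind.rep hφ ρ g (Ind.of k c x)) =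
        Ind.rep hφ σ g (Ind.map f (Ind.of k c x))
      rw [Ind.rep_of, Ind.map_of, Ind.map_of, Ind.rep_of, h]) y

variable {Δ : ι → Type u} [∀ k, MulAction (H k) (Δ k)] {Δ' : Type u} [MulAction G Δ']

/-- On the summand of a coset `c`, the section of `V k` is carried to `Δ'` by `f k` and translated
by the representative of `c`; the cocycle measures exactly the failure of representatives to be
equivariant. -/
theorem RelProj.ind (hφ : ∀ k, Function.Injective (φ k)) {ρ : ∀ k, AddRep (H k) (V k)}
    (f : ∀ k, Δ k → Δ') (hf : ∀ k (x : H k) δ, f k (x • δ) = φ k x • f k δ)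
    (h : ∀ k, RelProj (Δ k) (ρ k)) : RelProj Δ' (Ind.rep hφ ρ) := by
  choose π hπ hs using h
  let F : ∀ k, G ⧸ (φ k).range → (Δ k →₀ V k) →+ (Δ' →₀ Ind φ V) := fun k c =>
    Finsupp.liftAddHom fun δ =>
      (Finsupp.singleAddHom ((Quotient.out c : G) • f k δ)).comp (Ind.of k c)
  have hF0 : ∀ k c δ x, F k c (Finsupp.single δ x) =
      Finsupp.single ((Quotient.out c : G) • f k δ) (Ind.of k c x) := fun k c δ x => by simp [F]
  have hF : ∀ g k c, (F k (g • c)).comp (twist (Δ k) (ρ k) (cosetCocycle (φ k) g c)) =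
      (twist Δ' (Ind.rep hφ ρ) g).comp (F k c) := fun g k c =>
    Finsupp.addHom_ext fun δ x => by
      rw [AddMonoidHom.comp_apply, AddMonoidHom.comp_apply, twist_single, hF0, hF0, twist_single,
        Ind.rep_of, hf, ← mul_smul, ← mul_smul, out_mul_cosetCocycle]
  have hF' : ∀ k c, (total Δ' (Ind φ V)).comp (F k c) = (Ind.of k c).comp (total (Δ k) (V k)) :=
    fun k c => Finsupp.addHom_ext fun δ x => by
      rw [AddMonoidHom.comp_apply, AddMonoidHom.comp_apply, hF0, total_single, total_single]
  let L : Ind φ V →+ (Δ' →₀ Ind φ V) := Ind.lift fun k c => (F k c).comp (π k)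
  have hL : ∀ k c x, L (Ind.of k c x) = F k c (π k x) := fun k c x => Ind.lift_of _ k c x
  refine ⟨L, fun g => ?_, ?_⟩
  · refine Ind.apply_ext (L.comp (Ind.rep hφ ρ g)) ((twist Δ' (Ind.rep hφ ρ) g).comp L)
      fun k c x => ?_
    refine (congrArg L (Ind.rep_of hφ ρ g k c x)).trans ?_
    rw [AddMonoidHom.comp_apply, hL, hL, hπ]
    exact DFunLike.congr_fun (hF g k c) _
  · refine Ind.apply_ext ((total Δ' (Ind φ V)).comp L) (AddMonoidHom.id _) fun k c x => ?_
    rw [AddMonoidHom.comp_apply, hL]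
    refine (DFunLike.congr_fun (hF' k c) _).trans ?_
    rw [AddMonoidHom.comp_apply, hs, AddMonoidHom.id_apply]

/-- Induction preserves relatively split extensions. -/
noncomputable def RelSplit.ind (hφ : ∀ k, Function.Injective (φ k)) {ρ : ∀ k, AddRep (H k) (U k)}
    {σ : ∀ k, AddRep (H k) (V k)} {τ : ∀ k, AddRep (H k) (W k)}
    (f : ∀ k, Δ' → Δ k) (hf : ∀ k (x : H k) δ, f k (φ k x • δ) = x • f k δ)
    (S : ∀ k, RelSplit (Δ k) (ρ k) (σ k) (τ k)) :
    RelSplit Δ' (Ind.rep hφ ρ) (Ind.rep hφ σ) (Ind.rep hφ τ) :=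
  -- On the summand of `c`, the splitting for `δ` is that of the point `δ` pulled back by the
  -- representative of `c`; this point transforms by the cocycle.
  have key : ∀ (g : G) k (c : G ⧸ (φ k).range) (δ : Δ'),
      f k ((Quotient.out (g • c) : G)⁻¹ • g • δ) =
        cosetCocycle (φ k) g c • f k ((Quotient.out c : G)⁻¹ • δ) := fun g k c δ => by
    rw [← hf, map_cosetCocycle, ← mul_smul, ← mul_smul]
    congr 2
    group
  { i := Ind.map fun k _ => (S k).i
    p := Ind.map fun k _ => (S k).p
    t := fun δ => Ind.map fun k c => (S k).t (f k ((Quotient.out c : G)⁻¹ • δ))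
    u := fun δ => Ind.map fun k c => (S k).u (f k ((Quotient.out c : G)⁻¹ • δ))
    i_equiv := fun g => Ind.map_equiv hφ g fun k c x => (S k).i_equiv _ _
    p_equiv := fun g => Ind.map_equiv hφ g fun k c x => (S k).p_equiv _ _
    t_equiv := fun g δ => Ind.map_equiv hφ g fun k c x => by rw [key, (S k).t_equiv]
    u_equiv := fun g δ => Ind.map_equiv hφ g fun k c x => by rw [key, (S k).u_equiv]
    p_i := Ind.apply_ext ((Ind.map fun k _ => (S k).p).comp (Ind.map fun k _ => (S k).i)) 0
      fun k c x => by
        rw [AddMonoidHom.comp_apply, Ind.map_of, Ind.map_of, (S k).p_i, map_zero]; rfl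
    u_i := fun δ => Ind.apply_ext ((Ind.map fun k c =>
        (S k).u (f k ((Quotient.out c : G)⁻¹ • δ))).comp (Ind.map fun k _ => (S k).i))
      (AddMonoidHom.id _) fun k c x => by
        rw [AddMonoidHom.comp_apply, Ind.map_of, Ind.map_of, (S k).u_i]; rfl
    p_t := fun δ => Ind.apply_ext ((Ind.map fun k _ => (S k).p).comp (Ind.map fun k c =>
        (S k).t (f k ((Quotient.out c : G)⁻¹ • δ))))
      (AddMonoidHom.id _) fun k c x => by
        rw [AddMonoidHom.comp_apply, Ind.map_of, Ind.map_of, (S k).p_t]; rfl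
    add := fun δ => Ind.apply_ext
      ((Ind.map fun k _ => (S k).i).comp (Ind.map fun k c =>
          (S k).u (f k ((Quotient.out c : G)⁻¹ • δ))) +
        (Ind.map fun k c => (S k).t (f k ((Quotient.out c : G)⁻¹ • δ))).comp
          (Ind.map fun k _ => (S k).p))
      (AddMonoidHom.id _) fun k c x => by
        rw [AddMonoidHom.add_apply, AddMonoidHom.comp_apply, AddMonoidHom.comp_apply, Ind.map_of,
          Ind.map_of, Ind.map_of, Ind.map_of, ← map_add, (S k).add]; rfl }

/-- Comparison maps are needed both ways: `f` transports relative projectivity to `Δ'`, while `f'`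
transports splittings. -/
theorem RelDimLE.ind (hφ : ∀ k, Function.Injective (φ k))
    (f : ∀ k, Δ k → Δ') (hf : ∀ k (x : H k) δ, f k (x • δ) = φ k x • f k δ)
    (f' : ∀ k, Δ' → Δ k) (hf' : ∀ k (x : H k) δ, f' k (φ k x • δ) = x • f' k δ) (n : ℕ) :
    ∀ (V : ι → Type u) [∀ k, AddCommGroup (V k)] (ρ : ∀ k, AddRep (H k) (V k)),
      (∀ k, RelDimLE (Δ k) n (V k) (ρ k)) → RelDimLE Δ' n (Ind φ V) (Ind.rep hφ ρ) := by
  induction n with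
  | zero => exact fun V _ ρ h => RelProj.ind hφ f hf h
  | succ n ih =>
    intro V _ ρ h
    choose K P _ _ κ π hP hS hK using h
    exact ⟨Ind φ K, Ind φ P, inferInstance, inferInstance, Ind.rep hφ κ, Ind.rep hφ π,
      RelProj.ind hφ f hf hP, ⟨RelSplit.ind hφ f' hf' fun k => (hS k).some⟩, ih K κ hK⟩

end Induction

/-! ### Permutation modules and free modules -/

section Permutation

variable {G : Type u} [Group G]

/-- The permutation module of a `G`-set. -/
noncomputable def permRep (G X : Type*) [Group G] [MulAction G X] : AddRep G (X →₀ ℤ) where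
  toFun g := Finsupp.mapDomain.addMonoidHom (g • ·)
  map_one' := Finsupp.addHom_ext fun x n => by
    rw [Finsupp.mapDomain.addMonoidHom_apply, Finsupp.mapDomain_single, one_smul]; rfl
  map_mul' g h := Finsupp.addHom_ext fun x n => by
    rw [Finsupp.mapDomain.addMonoidHom_apply, Finsupp.mapDomain_single, mul_smul]
    change _ = Finsupp.mapDomain (g • ·) (Finsupp.mapDomain (h • ·) (Finsupp.single x n))
    rw [Finsupp.mapDomain_single, Finsupp.mapDomain_single]

@[simp] theorem permRep_single {G X : Type*} [Group G] [MulAction G X] (g : G) (x : X) (n : ℤ) :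
    permRep G X g (Finsupp.single x n) = Finsupp.single (g • x) n :=
  Finsupp.mapDomain_single

/-- Each basis element `x` is placed over `f x`. -/
theorem RelProj.permRep {X Δ : Type u} [MulAction G X] [MulAction G Δ] (f : X → Δ)
    (hf : ∀ (g : G) x, f (g • x) = g • f x) : RelProj Δ (permRep G X) := by
  let π : (X →₀ ℤ) →+ (Δ →₀ X →₀ ℤ) :=
    Finsupp.liftAddHom fun x => (Finsupp.singleAddHom (f x)).comp (Finsupp.singleAddHom x)
  have hπ0 : ∀ x n, π (Finsupp.single x n) = Finsupp.single (f x) (Finsupp.single x n) :=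
    fun x n => by simp [π]
  refine ⟨π, fun g => DFunLike.congr_fun (Finsupp.addHom_ext (f := π.comp (_root_.permRep G X g))
    (g := (twist Δ (_root_.permRep G X) g).comp π) fun x n => ?_),
    DFunLike.congr_fun (Finsupp.addHom_ext (f := (total Δ _).comp π) (g := AddMonoidHom.id _)
      fun x n => ?_)⟩
  · refine (congrArg π (permRep_single g x n)).trans ?_
    rw [AddMonoidHom.comp_apply, hπ0, hπ0, twist_single, permRep_single, hf]
  · rw [AddMonoidHom.comp_apply, hπ0, total_single, AddMonoidHom.id_apply]

/-- Additive maps out of a free abelian group agree if they agree on the basis. -/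
theorem addHom_ext_single {X A : Type*} [AddCommGroup A] {a b : (X →₀ ℤ) →+ A}
    (h : ∀ x, a (Finsupp.single x 1) = b (Finsupp.single x 1)) : a = b :=
  Finsupp.addHom_ext' fun x => AddMonoidHom.ext_int (h x)

variable {ι : Type} {A : Type*} [AddCommGroup A] (α : AddRep G A)

/-- The homomorphism from the free `G`-module on `ι` with prescribed values on the basis. -/
noncomputable def freeLift (e : ι → A) : ((Σ _ : ι, G) →₀ ℤ) →+ A :=
  Finsupp.liftAddHom fun x => zmultiplesHom A (α x.2 (e x.1))

@[simp] theorem freeLift_single (e : ι → A) (k : ι) (g : G) :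
    freeLift α e (Finsupp.single ⟨k, g⟩ 1) = α g (e k) := by
  simp [freeLift]

theorem freeLift_equiv (e : ι → A) (g : G) (x) :
    freeLift α e (permRep G (Σ _ : ι, G) g x) = α g (freeLift α e x) := by
  refine DFunLike.congr_fun (addHom_ext_single (a := (freeLift α e).comp (permRep G _ g))
    (b := (α g : A →+ A).comp (freeLift α e)) fun x => ?_) x
  obtain ⟨k, h⟩ := x
  refine (congrArg (freeLift α e) (permRep_single g _ 1)).trans ?_
  refine Eq.trans ?_ (congrArg (α g) (freeLift_single α e k h)).symm
  rw [Sigma.smul_mk, freeLift_single, smul_eq_mul, AddRep.mul_apply]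

end Permutation

/-! ### Averaging over a finite subgroup -/

section Averaging

open scoped Classical

variable {ι : Type} {G : Type u} [Group G]

/-- Derivations of a finite subgroup with values in a free module are principal. -/
theorem exists_principal (S : Subgroup G) [Finite S] (D : G → ((Σ _ : ι, G) →₀ ℤ))
    (hD : ∀ g h, D (g * h) = D g + permRep G _ g (D h)) :
    ∃ e, ∀ h ∈ S, permRep G _ h e = e - D h := by
  have := Fintype.ofFinite S
  obtain ⟨T, hT, -⟩ := S.exists_isComplement_right 1
  rw [Subgroup.isComplement_iff_existsUnique_inv_mul_mem] at hT
  -- The translates `xT`, for `x` in `S`, partition `G`. The projections `q x` onto the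
  -- corresponding summands add up to the identity and are permuted by `S`.
  let q : G → ((Σ _ : ι, G) →₀ ℤ) →+ ((Σ _ : ι, G) →₀ ℤ) := fun x =>
    Finsupp.liftAddHom fun y => if x⁻¹ * y.2 ∈ T then Finsupp.singleAddHom y else 0
  have hq0 : ∀ x k g, q x (Finsupp.single ⟨k, g⟩ 1) =
      if x⁻¹ * g ∈ T then Finsupp.single ⟨k, g⟩ 1 else 0 := fun x k g => by
    simp only [q, Finsupp.liftAddHom_apply_single]
    split_ifs <;> rfl
  have hq : ∀ h x y, permRep G _ h (q x y) = q (h * x) (permRep G _ h y) := fun h x y => by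
    refine DFunLike.congr_fun (addHom_ext_single (a := AddMonoidHom.comp (permRep G _ h) (q x))
      (b := (q (h * x)).comp (permRep G _ h)) fun z => ?_) y
    obtain ⟨k, g⟩ := z
    refine Eq.trans ?_ (congrArg (q (h * x)) (permRep_single h _ 1)).symm
    refine (congrArg (permRep G _ h) (hq0 x k g)).trans ?_
    rw [Sigma.smul_mk, hq0, smul_eq_mul, mul_inv_rev, mul_assoc, inv_mul_cancel_left]
    split_ifs
    · rw [permRep_single]; rfl
    · exact map_zero _
  have hsum : ∀ y, ∑ x : S, q x y = y := fun y => by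
    refine (AddMonoidHom.finsetSum_apply _ _ _).symm.trans (DFunLike.congr_fun
      (addHom_ext_single (a := ∑ x : S, q x) (b := AddMonoidHom.id _) fun z => ?_) y)
    obtain ⟨k, g⟩ := z
    obtain ⟨s, hs, hu⟩ := hT g
    rw [AddMonoidHom.finsetSum_apply]
    refine (Finset.sum_eq_single (M := (Σ _ : ι, G) →₀ ℤ) (ι := S) s (fun x _ hx => ?_)
      fun h => absurd (Finset.mem_univ _) h).trans ?_
    · rw [hq0, if_neg fun h => hx (hu x h)]
    · rw [hq0, if_pos hs]; rfl
  -- Averaging over `S`, with the partition of the identity in place of division by the order of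
  -- `S`.
  refine ⟨∑ x : S, q x (D x), fun h hh => ?_⟩
  have h1 : ∀ x : S, permRep G _ h (q x (D x)) = q (h * x) (D (h * x)) - q (h * x) (D h) :=
    fun x => by rw [hq, ← map_sub, hD, add_sub_cancel_left]
  rw [map_sum, Finset.sum_congr rfl fun x _ => h1 x, Finset.sum_sub_distrib]
  congr 1
  · exact Equiv.sum_comp (Equiv.mulLeft (⟨h, hh⟩ : S)) fun x : S => q x (D x)
  · exact (Equiv.sum_comp (Equiv.mulLeft (⟨h, hh⟩ : S)) fun x : S => q x (D h)).trans (hsum _)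

end Averaging

/-! ### The tree of a free product -/

section FreeProduct

variable {ι : Type} (H : ι → Type u) [∀ k, Group (H k)]

/-- The additive group freely spanned by the edges. -/
abbrev Edges : Type u := (Σ _ : ι, Monoid.CoprodI H) →₀ ℤ

/-- The edge module. -/
noncomputable abbrev edgeRep : AddRep (Monoid.CoprodI H) (Edges H) :=
  permRep (Monoid.CoprodI H) (Σ _ : ι, Monoid.CoprodI H)

variable {H}

/-- The edge that joins the vertex `g` to the coset of `g` modulo `H k`. -/
noncomputable def edge (k : ι) (g : Monoid.CoprodI H) : Edges H := Finsupp.single ⟨k, g⟩ 1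

theorem edgeRep_edge (g h : Monoid.CoprodI H) (k : ι) :
    edgeRep H g (edge k h) = edge k (g * h) :=
  permRep_single g _ 1

/-- Let each factor `H k` act on `Edges H` by affine maps fixing `edge k 1`. The universal property
assembles these into an affine action of the free product, and `D g` is the image of `0`.
Geometrically, `D g` is the path from the vertex `1` to the vertex `g`. -/
theorem exists_edge_derivation : ∃ D : Monoid.CoprodI H → Edges H,
    (∀ g h, D (g * h) = D g + edgeRep H g (D h)) ∧
      ∀ k (x : H k), D (Monoid.CoprodI.of x) = edge k 1 - edge k (Monoid.CoprodI.of x) := by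
  let L : Monoid.CoprodI H →* Function.End (Edges H) := Monoid.CoprodI.lift fun k =>
    { toFun := fun x => fun e => edgeRep H (Monoid.CoprodI.of x) (e - edge k 1) + edge k 1
      map_one' := funext fun e => by
        rw [map_one, AddRep.one_apply, sub_add_cancel]; rfl
      map_mul' := fun x y => funext fun e => by
        change _ = edgeRep H (Monoid.CoprodI.of x) (edgeRep H (Monoid.CoprodI.of y) (e - edge k 1) +
          edge k 1 - edge k 1) + edge k 1
        rw [map_mul, AddRep.mul_apply, add_sub_cancel_right] }
  have hLof : ∀ k (x : H k) e, L (Monoid.CoprodI.of x) e =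
      edgeRep H (Monoid.CoprodI.of x) (e - edge k 1) + edge k 1 := fun k x e => by
    simp only [L, Monoid.CoprodI.lift_of]; rfl
  have hL : ∀ g e, L g e = edgeRep H g e + L g 0 := fun g => by
    induction g using Monoid.CoprodI.induction_on with
    | one =>
      intro e
      rw [AddRep.one_apply, map_one]
      exact (add_zero e).symm
    | of k x =>
      intro e
      rw [hLof, hLof, map_sub, zero_sub, map_neg]
      abel
    | mul x y hx hy =>
      intro e
      rw [map_mul]
      change L x (L y e) = _ + L x (L y 0)
      rw [hx, hy, hx (L y 0), AddRep.mul_apply, map_add]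
      abel
  refine ⟨fun g => L g 0, fun g h => ?_, fun k x => ?_⟩
  · refine (congrFun (map_mul L g h) 0).trans ?_
    change L g (L h 0) = _
    rw [hL, add_comm]
  · change L (Monoid.CoprodI.of x) 0 = _
    rw [hLof, zero_sub, map_neg, edgeRep_edge, mul_one]
    abel

variable (H) in
/-- The canonical inclusions of the factors. -/
abbrev factor (k : ι) : H k →* Monoid.CoprodI H := Monoid.CoprodI.of

theorem factor_injective (k : ι) : Function.Injective (factor H k) :=
  Monoid.CoprodI.of_injective k

variable (H) in
/-- The vertex module: cosets of the factors, and group elements. -/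
abbrev Vertices : Type u :=
  Ind (factor H) (fun _ => ULift.{u} ℤ) × (Monoid.CoprodI H →₀ ℤ)

variable (H) in
/-- The action on the vertex module. -/
noncomputable def vertexRep : AddRep (Monoid.CoprodI H) (Vertices H) :=
  (Ind.rep factor_injective fun _ => 1).prod (permRep (Monoid.CoprodI H) (Monoid.CoprodI H))

/-- The vertex given by the coset of `g` modulo `H k`. -/
noncomputable def cosetVertex (k : ι) (g : Monoid.CoprodI H) : Vertices H :=
  (Ind.of k (QuotientGroup.mk g) ⟨1⟩, 0)

/-- The vertex given by `g`. -/
noncomputable def pointVertex (g : Monoid.CoprodI H) : Vertices H := (0, Finsupp.single g 1)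

theorem vertexRep_cosetVertex (g h : Monoid.CoprodI H) (k : ι) :
    vertexRep H g (cosetVertex k h) = cosetVertex k (g * h) := by
  rw [vertexRep, AddRep.prod_apply]
  refine Prod.ext ?_ (map_zero _)
  exact Ind.rep_of _ _ _ _ _ _

theorem vertexRep_pointVertex (g h : Monoid.CoprodI H) :
    vertexRep H g (pointVertex h) = pointVertex (g * h) := by
  rw [vertexRep, AddRep.prod_apply]
  refine Prod.ext (map_zero _) ?_
  exact permRep_single _ _ _

theorem cosetVertex_mul_of (g : Monoid.CoprodI H) (k : ι) (x : H k) :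
    cosetVertex k (g * Monoid.CoprodI.of x) = cosetVertex k g := by
  have : (QuotientGroup.mk (g * Monoid.CoprodI.of x) :
      Monoid.CoprodI H ⧸ (factor H k).range) = QuotientGroup.mk g :=
    QuotientGroup.mk_mul_of_mem g ⟨x, rfl⟩
  rw [cosetVertex, this, cosetVertex]

theorem uliftInt_hom_ext {A : Type*} [AddCommGroup A] {a b : ULift.{u} ℤ →+ A}
    (h : a ⟨1⟩ = b ⟨1⟩) : a = b := by
  have : a.comp AddEquiv.ulift.symm.toAddMonoidHom = b.comp AddEquiv.ulift.symm.toAddMonoidHom :=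
    AddMonoidHom.ext_int h
  exact AddMonoidHom.ext fun x => DFunLike.congr_fun this x.down

theorem Vertices.apply_ext {A : Type*} [AddCommGroup A] (a b : Vertices H →+ A)
    (hc : ∀ k g, a (cosetVertex k g) = b (cosetVertex k g))
    (hp : ∀ g, a (pointVertex g) = b (pointVertex g)) (y : Vertices H) : a y = b y := by
  have h1 : a.comp (AddMonoidHom.inl _ _) = b.comp (AddMonoidHom.inl _ _) := by
    refine Ind.hom_ext fun k c x => ?_
    let l : ULift.{u} ℤ →+ Vertices H := 
      (AddMonoidHom.inl _ _).comp (Ind.of (V := fun _ => ULift.{u} ℤ) k c)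
    refine DFunLike.congr_fun (uliftInt_hom_ext (a := a.comp l) (b := b.comp l) ?_) x
    induction c using QuotientGroup.induction_on with
    | H g => exact hc k g
  have h2 : a.comp (AddMonoidHom.inr _ _) = b.comp (AddMonoidHom.inr _ _) :=
    addHom_ext_single fun g => hp g
  have h3 := DFunLike.congr_fun h1 y.1
  have h4 := DFunLike.congr_fun h2 y.2
  have h5 : y = AddMonoidHom.inl _ _ y.1 + AddMonoidHom.inr _ _ y.2 := by simp
  rw [h5, map_add, map_add]
  exact congrArg₂ _ h3 h4

/-- The augmentation of the vertex module. -/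
noncomputable def vertexAug : Vertices H →+ ULift.{u} ℤ :=
  (Ind.lift fun _ _ => AddMonoidHom.id _).coprod
    (Finsupp.liftAddHom fun _ => AddEquiv.ulift.symm.toAddMonoidHom)

theorem vertexAug_cosetVertex (k : ι) (g : Monoid.CoprodI H) :
    vertexAug (cosetVertex k g) = ⟨1⟩ := by
  rw [vertexAug, cosetVertex, AddMonoidHom.coprod_apply, map_zero, add_zero, Ind.lift_of]
  rfl

theorem vertexAug_pointVertex (g : Monoid.CoprodI H) : vertexAug (pointVertex g) = ⟨1⟩ := by
  rw [vertexAug, pointVertex, AddMonoidHom.coprod_apply, map_zero, zero_add,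
    Finsupp.liftAddHom_apply_single]
  rfl

theorem vertexAug_equiv (g : Monoid.CoprodI H) (y : Vertices H) :
    vertexAug (vertexRep H g y) = vertexAug y := by
  refine Vertices.apply_ext (vertexAug.comp (vertexRep H g)) vertexAug (fun k h => ?_)
    (fun h => ?_) y
  · refine (congrArg vertexAug (vertexRep_cosetVertex g h k)).trans ?_
    rw [vertexAug_cosetVertex, vertexAug_cosetVertex]
  · refine (congrArg vertexAug (vertexRep_pointVertex g h)).trans ?_
    rw [vertexAug_pointVertex, vertexAug_pointVertex]

/-- The boundary map of the tree. -/
noncomputable def boundary : Edges H →+ Vertices H :=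
  freeLift (vertexRep H) fun k => cosetVertex k 1 - pointVertex 1

theorem boundary_edge (k : ι) (g : Monoid.CoprodI H) :
    boundary (edge k g) = cosetVertex k g - pointVertex g := by
  rw [boundary, edge, freeLift_single, map_sub, vertexRep_cosetVertex, vertexRep_pointVertex,
    mul_one]

theorem boundary_equiv (g : Monoid.CoprodI H) (x : Edges H) :
    boundary (edgeRep H g x) = vertexRep H g (boundary x) :=
  freeLift_equiv _ _ _ _

theorem vertexAug_boundary (x : Edges H) : vertexAug (boundary x) = 0 := by
  refine DFunLike.congr_fun (addHom_ext_single (a := vertexAug.comp boundary) (b := 0)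
    fun z => ?_) x
  refine (congrArg vertexAug (boundary_edge z.1 z.2)).trans ?_
  rw [map_sub, vertexAug_cosetVertex, vertexAug_pointVertex, sub_self]; rfl

section Derivation

variable {D : Monoid.CoprodI H → Edges H} (hD : ∀ g h, D (g * h) = D g + edgeRep H g (D h))
  (hDof : ∀ k (x : H k), D (Monoid.CoprodI.of x) = edge k 1 - edge k (Monoid.CoprodI.of x))
include hD

theorem derivation_one : D 1 = 0 := by
  have := hD 1 1
  rw [mul_one, AddRep.one_apply] at this
  exact left_eq_add.1 this

include hDof

/-- For `x` in a factor, the path runs from `1` to `x` through their common coset vertex; products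
concatenate translated paths. -/
theorem boundary_derivation (g : Monoid.CoprodI H) :
    boundary (D g) = pointVertex g - pointVertex 1 := by
  induction g using Monoid.CoprodI.induction_on with
  | one => rw [derivation_one hD, map_zero, sub_self]
  | of k x =>
    rw [hDof, map_sub, boundary_edge, boundary_edge]
    have := cosetVertex_mul_of 1 k x
    rw [one_mul] at this
    rw [this]
    abel
  | mul x y hx hy =>
    rw [hD, map_add, hx, boundary_equiv, hy, map_sub, vertexRep_pointVertex, vertexRep_pointVertex,
      mul_one]
    abel

/-- The boundary map of the tree has an additive retraction. -/
theorem exists_boundary_retraction : ∃ r : Vertices H →+ Edges H,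
    (∀ g, r (pointVertex g) = D g) ∧ ∀ k g, r (cosetVertex k g) = D g + edge k g := by
  let r : Vertices H →+ Edges H :=
    (Ind.lift fun k c => (zmultiplesHom _ (D (Quotient.out c) + edge k (Quotient.out c))).comp
      AddEquiv.ulift.toAddMonoidHom).coprod (Finsupp.liftAddHom fun g => zmultiplesHom _ (D g))
  refine ⟨r, fun g => ?_, fun k g => ?_⟩
  · simp only [r]
    rw [pointVertex, AddMonoidHom.coprod_apply, map_zero, zero_add,
      Finsupp.liftAddHom_apply_single]
    simp
  · simp only [r]
    rw [cosetVertex, AddMonoidHom.coprod_apply, map_zero, add_zero, Ind.lift_of]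
    -- The value `D g + edge k g` depends only on the coset: passing from `s` to `s * x` with `x` in
    -- `H k` changes the two terms by opposite amounts.
    obtain ⟨x, hx⟩ : (QuotientGroup.mk g : Monoid.CoprodI H ⧸ (factor H k).range).out⁻¹ * g ∈
        (factor H k).range := QuotientGroup.eq.1 (QuotientGroup.out_eq' _)
    generalize hs : (QuotientGroup.mk g : Monoid.CoprodI H ⧸ (factor H k).range).out = s at hx
    have hg : g = s * Monoid.CoprodI.of x := by
      rw [eq_comm, ← eq_inv_mul_iff_mul_eq]; exact hx
    change zmultiplesHom (Edges H) _ (1 : ℤ) = _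
    rw [zmultiplesHom_apply, one_smul, hg, hD, hDof, map_sub, edgeRep_edge, edgeRep_edge, mul_one]
    abel

/-- The retraction contracts the complex onto the vertex `1`, which gives exactness. For the
relative splitting, a finite subgroup must fix a chain of augmentation one; the vanishing of
derivation classes in `exists_principal` replaces the fixed point theorem for trees. -/
theorem exists_relSplit_boundary : ∃ T : RelSplit (FinSub (Monoid.CoprodI H)) (edgeRep H)
    (vertexRep H) (1 : AddRep (Monoid.CoprodI H) (ULift.{u} ℤ)), T.i = boundary := by
  obtain ⟨r, hrp, hrc⟩ := exists_boundary_retraction hD hDof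
  have hrj : ∀ x, r (boundary x) = x := DFunLike.congr_fun
    (addHom_ext_single (a := r.comp boundary) (b := AddMonoidHom.id _) fun z => by
      refine (congrArg r (boundary_edge z.1 z.2)).trans ?_
      rw [map_sub, hrc, hrp, add_sub_cancel_left]; rfl)
  let base : Vertices H →+ Vertices H := (zmultiplesHom (Vertices H) (pointVertex 1)).comp
    (AddEquiv.ulift.toAddMonoidHom.comp vertexAug)
  have hbase : ∀ y, base y = (vertexAug y).down • pointVertex 1 := fun y => rfl
  have hjr : ∀ y, boundary (r y) = y - (vertexAug y).down • pointVertex 1 :=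
    Vertices.apply_ext (boundary.comp r) (AddMonoidHom.id (Vertices H) - base)
      (fun k g => by
        rw [AddMonoidHom.comp_apply, hrc, map_add, boundary_derivation hD hDof, boundary_edge,
          AddMonoidHom.sub_apply, hbase, vertexAug_cosetVertex, one_smul, AddMonoidHom.id_apply]
        abel)
      (fun g => by
        rw [AddMonoidHom.comp_apply, hrp, boundary_derivation hD hDof, AddMonoidHom.sub_apply,
          hbase, vertexAug_pointVertex, one_smul, AddMonoidHom.id_apply])
  obtain ⟨v, hv, hvG⟩ := exists_equivariant_map (G := Monoid.CoprodI H)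
    (A := FinSub (Monoid.CoprodI H)) (B := Vertices H) (fun g y => vertexRep H g y)
    (vertexRep H).mul_apply (fun y => vertexAug y = ⟨1⟩)
    (fun g b hb => by rw [vertexAug_equiv, hb]) fun S => by
      have := S.finite_stabilizer
      obtain ⟨e, he⟩ := exists_principal (MulAction.stabilizer _ S) D hD
      -- Moving the vertex `1` by `g` adds the boundary of `D g`, which the change `e ↦ e - D g`
      -- cancels.
      refine ⟨pointVertex 1 + boundary e, ?_, fun g hg => ?_⟩
      · rw [map_add, vertexAug_boundary, vertexAug_pointVertex, add_zero]
      · rw [map_add, vertexRep_pointVertex, ← boundary_equiv, he g hg, map_sub,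
          boundary_derivation hD hDof, mul_one]
        abel
  obtain ⟨T, hT, -⟩ := RelSplit.of_exact (κ := edgeRep H) (π := vertexRep H)
    (ρ := (1 : AddRep (Monoid.CoprodI H) (ULift.{u} ℤ))) boundary vertexAug
    (fun S => (zmultiplesHom _ (v S)).comp AddEquiv.ulift.toAddMonoidHom)
    boundary_equiv vertexAug_equiv
    (fun g S x => by
      change x.down • v (g • S) = vertexRep H g (x.down • v S)
      rw [hvG, map_zsmul])
    (Function.LeftInverse.injective hrj) vertexAug_boundary
    (fun y hy => ⟨r y, by rw [hjr, hy]; simp⟩)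
    (fun S x => by
      change vertexAug (x.down • v S) = x
      rw [map_zsmul, hv]
      exact ULift.ext _ _ (by simp))
  exact ⟨T, hT⟩

end Derivation

/-- The free product has relative dimension at most `n + 1` if the factors have. -/
theorem RelDimLE.coprodI {n : ℕ}
    (h : ∀ k, RelDimLE (FinSub (H k)) (n + 1) (ULift.{u} ℤ) (1 : AddRep (H k) (ULift.{u} ℤ))) :
    RelDimLE (FinSub (Monoid.CoprodI H)) (n + 1) (ULift.{u} ℤ)
      (1 : AddRep (Monoid.CoprodI H) (ULift.{u} ℤ)) := by
  obtain ⟨D, hD, hDof⟩ := exists_edge_derivation (H := H)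
  obtain ⟨T, hT⟩ := exists_relSplit_boundary hD hDof
  -- Intersecting with a factor could give the empty set; instead, finiteness of the stabilizers
  -- supplies the map.
  have hback : ∀ k, ∃ f : FinSub (Monoid.CoprodI H) → FinSub (H k),
      ∀ (x : H k) S, f (factor H k x • S) = x • f S := fun k => by
    let _ : MulAction (H k) (FinSub (Monoid.CoprodI H)) := MulAction.compHom _ (factor H k)
    refine DetectsFiniteSubgroups.exists_equivariant FinSub.detectsFiniteSubgroups fun S => ?_
    have := S.finite_stabilizer
    exact Finite.of_injective (β := MulAction.stabilizer (Monoid.CoprodI H) S)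
      (fun x => ⟨factor H k x.1, x.2⟩)
      fun x y hxy => Subtype.ext (factor_injective k (congrArg Subtype.val hxy))
  choose f' hf' using hback
  have hfree : RelProj (FinSub (Monoid.CoprodI H)) (permRep (Monoid.CoprodI H) (Monoid.CoprodI H)) :=
    RelProj.permRep FinSub.single fun g x => (FinSub.smul_single g x).symm
  have hedge : RelProj (FinSub (Monoid.CoprodI H)) (edgeRep H) :=
    RelProj.permRep (fun z => FinSub.single z.2) fun g x => (FinSub.smul_single g x.2).symm
  have hV : RelDimLE (FinSub (Monoid.CoprodI H)) (n + 1) (Vertices H) (vertexRep H) :=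
    (RelDimLE.ind factor_injective (fun k => FinSub.map (factor H k))
      (fun k x S => FinSub.map_smul _ _ _) f' hf' (n + 1) _ _ h).prod hfree
  have : Nonempty (FinSub (Monoid.CoprodI H)) := ⟨FinSub.single 1⟩
  refine hV.cokernel hedge T fun P _ π p hp hpG => ?_
  -- Since the edge module is free on `ι`, it suffices to lift the boundaries of the basic edges.
  choose s hs using fun k => hp (cosetVertex k 1 - pointVertex 1)
  refine ⟨freeLift π s, freeLift_equiv π s, fun x => ?_⟩
  rw [hT]
  refine DFunLike.congr_fun (addHom_ext_single (a := p.comp (freeLift π s)) (b := boundary)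
    fun z => ?_) x
  obtain ⟨k, g⟩ := z
  rw [AddMonoidHom.comp_apply, freeLift_single, hpG, hs, boundary, freeLift_single]

end FreeProduct

/-! ### Resolutions and relative dimension -/

section Resolution

variable {G : Type u} [Group G]

/-- A resolution of `V` by relatively projective modules that is contractible over every finite
subgroup. -/
structure AddResolution (Δ : Type u) [MulAction G Δ] {V : Type u} [AddCommGroup V]
    (ρ : AddRep G V) where
  P : ℕ → Type u
  [addCommGroup : ∀ n, AddCommGroup (P n)]
  σ : ∀ n, AddRep G (P n)
  d : ∀ n, P (n + 1) →+ P n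
  ε : P 0 →+ V
  d_equiv : ∀ n g x, d n (σ (n + 1) g x) = σ n g (d n x)
  ε_equiv : ∀ g x, ε (σ 0 g x) = ρ g (ε x)
  relProj : ∀ n, RelProj Δ (σ n)
  exact_zero : Function.Exact (d 0) ε
  exact_succ : ∀ n, Function.Exact (d (n + 1)) (d n)
  split : ∀ S : Subgroup G, Finite S → ∃ (s₀ : V →+ P 0) (s : ∀ n, P n →+ P (n + 1)),
    (∀ g ∈ S, ∀ x, s₀ (ρ g x) = σ 0 g (s₀ x)) ∧
    (∀ g ∈ S, ∀ n x, s n (σ n g x) = σ (n + 1) g (s n x)) ∧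
    (∀ x, ε (s₀ x) = x) ∧ (∀ x, d 0 (s 0 x) + s₀ (ε x) = x) ∧
    ∀ n x, d (n + 1) (s (n + 1) x) + s n (d n x) = x

attribute [instance] AddResolution.addCommGroup

variable {Δ : Type u} [MulAction G Δ]

/-- The action on the kernel of an equivariant map. -/
def kerRep {V W : Type*} [AddCommGroup V] [AddCommGroup W] (ρ : AddRep G V) (τ : AddRep G W)
    (f : V →+ W) (hf : ∀ g x, f (ρ g x) = τ g (f x)) : AddRep G f.ker where
  toFun g := ((ρ g : V →+ V).comp f.ker.subtype).codRestrict f.ker fun x => by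
    have hx : f x = 0 := x.2
    change f (ρ g x) = 0
    rw [hf, hx, map_zero]
  map_one' := AddMonoidHom.ext fun x => Subtype.ext (ρ.one_apply x.1)
  map_mul' g h := AddMonoidHom.ext fun x => Subtype.ext (ρ.mul_apply g h x.1)

/-- The resolution of the kernel of the augmentation obtained by truncating a resolution. -/
def AddResolution.tail {V : Type u} [AddCommGroup V] {ρ : AddRep G V} (R : AddResolution Δ ρ) :
    AddResolution Δ (kerRep (R.σ 0) ρ R.ε R.ε_equiv) where
  P n := R.P (n + 1)
  σ n := R.σ (n + 1)
  d n := R.d (n + 1)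
  ε := (R.d 0).codRestrict R.ε.ker fun x => (R.exact_zero _).2 ⟨x, rfl⟩
  d_equiv n := R.d_equiv (n + 1)
  ε_equiv g x := Subtype.ext (R.d_equiv 0 g x)
  relProj n := R.relProj (n + 1)
  exact_zero x := Subtype.ext_iff.trans (R.exact_succ 0 x)
  exact_succ n := R.exact_succ (n + 1)
  split S hS := by
    obtain ⟨s₀, s, h0, hs, hε, hd0, hd⟩ := R.split S hS
    refine ⟨(s 0).comp R.ε.ker.subtype, fun n => s (n + 1), fun g hg x => hs g hg 0 x,
      fun g hg n x => hs g hg (n + 1) x, fun x => Subtype.ext ?_, hd 0, fun n => hd (n + 1)⟩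
    have hx : R.ε x = 0 := x.2
    have := hd0 x
    rwa [hx, map_zero, add_zero] at this

/-- Peel off one term at a time, replacing `V` by the kernel of the augmentation. At length zero,
the contraction makes the augmentation an isomorphism. -/
theorem AddResolution.relDimLE (hΔ : ∀ δ : Δ, Finite (MulAction.stabilizer G δ)) (n : ℕ) :
    ∀ {V : Type u} [AddCommGroup V] {ρ : AddRep G V} (R : AddResolution Δ ρ),
      (∀ m, n < m → Subsingleton (R.P m)) → RelDimLE Δ n V ρ := by
  induction n with
  | zero =>
    intro V _ ρ R hR
    obtain ⟨s₀, s, -, -, hε, hd0, -⟩ := R.split ⊥ inferInstance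
    have := hR 1 one_pos
    have hs : ∀ x, s₀ (R.ε x) = x := fun x => by
      have h := hd0 x
      rwa [Subsingleton.elim (s 0 x) 0, map_zero, zero_add] at h
    exact (R.relProj 0).map id (fun _ _ => rfl) s₀
      (fun g x => by
        conv_lhs => rw [← hε x, ← R.ε_equiv]
        exact hs _)
      R.ε R.ε_equiv hε
  | succ n ih =>
    intro V _ ρ R hR
    refine ⟨R.ε.ker, R.P 0, inferInstance, inferInstance, kerRep (R.σ 0) ρ R.ε R.ε_equiv, R.σ 0,
      R.relProj 0, ?_, ih R.tail fun m hm => hR (m + 1) (Nat.succ_lt_succ hm)⟩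
    -- Sections equivariant under point stabilizers are spread over `Δ` using the conjugation action
    -- on additive maps `V →+ R.P 0`.
    obtain ⟨t, ht, htG⟩ := exists_equivariant_map (G := G) (A := Δ) (B := V →+ R.P 0)
      (fun g b => (R.σ 0 g : R.P 0 →+ R.P 0).comp (b.comp (ρ g⁻¹)))
      (fun g h b => AddMonoidHom.ext fun x => by
        change R.σ 0 (g * h) (b (ρ (g * h)⁻¹ x)) = R.σ 0 g (R.σ 0 h (b (ρ h⁻¹ (ρ g⁻¹ x))))
        rw [mul_inv_rev, AddRep.mul_apply, AddRep.mul_apply])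
      (fun b => ∀ x, R.ε (b x) = x)
      (fun g b hb x => by
        change R.ε (R.σ 0 g (b (ρ g⁻¹ x))) = x
        rw [R.ε_equiv, hb, ← AddRep.mul_apply, mul_inv_cancel, AddRep.one_apply])
      fun δ => by
        obtain ⟨s₀, -, h0, -, hε, -⟩ := R.split _ (hΔ δ)
        refine ⟨s₀, hε, fun g hg => AddMonoidHom.ext fun x => ?_⟩
        change R.σ 0 g (s₀ (ρ g⁻¹ x)) = s₀ x
        rw [← h0 g hg, ← AddRep.mul_apply, mul_inv_cancel, AddRep.one_apply]
    obtain ⟨S, -⟩ := RelSplit.of_exact (κ := kerRep (R.σ 0) ρ R.ε R.ε_equiv) (π := R.σ 0) (ρ := ρ)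
      R.ε.ker.subtype R.ε t (fun g x => rfl) R.ε_equiv
      (fun g δ x => by
        rw [htG]
        change R.σ 0 g (t δ (ρ g⁻¹ (ρ g x))) = _
        rw [← AddRep.mul_apply, inv_mul_cancel, AddRep.one_apply])
      Subtype.val_injective (fun x => x.2) (fun x hx => ⟨⟨x, hx⟩, rfl⟩) ht
    exact ⟨S⟩

/-- The sequence of types `P, Q 0, Q 1, …`. -/
def consType (P : Type u) (Q : ℕ → Type u) : ℕ → Type u
  | 0 => P
  | n + 1 => Q n

instance consType.addCommGroup (P : Type u) (Q : ℕ → Type u) [AddCommGroup P]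
    [∀ n, AddCommGroup (Q n)] : ∀ n, AddCommGroup (consType P Q n)
  | 0 => inferInstanceAs (AddCommGroup P)
  | n + 1 => inferInstanceAs (AddCommGroup (Q n))

/-- Splicing a resolution of `K` with a relatively split extension `K → P → V`. -/
def RelSplit.splice {K P V : Type u} [AddCommGroup K] [AddCommGroup P] [AddCommGroup V]
    {κ : AddRep G K} {π : AddRep G P} {ρ : AddRep G V} (hΔ : DetectsFiniteSubgroups G Δ)
    (T : RelSplit Δ κ π ρ) (hP : RelProj Δ π) (R : AddResolution Δ κ) : AddResolution Δ ρ where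
  P := consType P R.P
  σ
    | 0 => π
    | n + 1 => R.σ n
  d
    | 0 => T.i.comp R.ε
    | n + 1 => R.d n
  ε := T.p
  d_equiv
    | 0 => fun g x => (congrArg T.i (R.ε_equiv g x)).trans (T.i_equiv g _)
    | n + 1 => R.d_equiv n
  ε_equiv := T.p_equiv
  relProj
    | 0 => hP
    | n + 1 => R.relProj n
  exact_zero := by
    obtain ⟨δ, -⟩ := (hΔ ⊥).2 inferInstance
    obtain ⟨s₀, -, -, -, hε, -⟩ := R.split ⊥ inferInstance
    refine fun (x : P) => ⟨fun hx => ⟨s₀ (T.u δ x), ?_⟩, ?_⟩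
    · change T.i (R.ε (s₀ (T.u δ x))) = x
      have := T.add δ x
      rwa [show T.p x = 0 from hx, map_zero, add_zero, ← hε (T.u δ x)] at this
    · rintro ⟨y, rfl⟩
      exact T.p_i _
  exact_succ
    | 0 => by
      obtain ⟨δ, -⟩ := (hΔ ⊥).2 inferInstance
      refine fun x => Iff.trans ⟨fun hx => ?_, fun hx => ?_⟩ (R.exact_zero x)
      · have hx' : T.i (R.ε x) = 0 := hx
        rw [← T.u_i δ (R.ε x), hx', map_zero]
      · change T.i (R.ε x) = 0
        rw [hx, map_zero]
    | n + 1 => R.exact_succ n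
  split S hS := by
    -- At a point fixed by `S`, the maps `T.t δ` and `T.u δ` are `S`-equivariant.
    obtain ⟨δ, hδ⟩ := (hΔ S).2 hS
    obtain ⟨s₀, s, h0, hs, hε, hd0, hd⟩ := R.split S hS
    have hfix : ∀ g ∈ S, g • δ = δ := fun g hg => hδ ⟨g, hg⟩
    refine ⟨T.t δ, fun
      | 0 => s₀.comp (T.u δ)
      | n + 1 => s n, fun g hg x => ?_, fun g hg n => ?_, T.p_t δ, fun (x : P) => ?_, fun n => ?_⟩
    · have := T.t_equiv g δ x
      rwa [hfix g hg] at this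
    · cases n with
      | zero =>
        intro x
        have := T.u_equiv g δ x
        rw [hfix g hg] at this
        exact (congrArg s₀ this).trans (h0 g hg _)
      | succ n => exact hs g hg n
    · change T.i (R.ε (s₀ (T.u δ x))) + T.t δ (T.p x) = x
      rw [hε, T.add]
    · cases n with
      | zero =>
        intro (x : R.P 0)
        change R.d 0 (s 0 x) + s₀ (T.u δ (T.i (R.ε x))) = x
        rw [T.u_i, hd0]
      | succ n => exact hd n

/-- The zero resolution. -/
def AddResolution.zero : AddResolution Δ (1 : AddRep G PUnit.{u + 1}) where
  P _ := PUnit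
  σ _ := 1
  d _ := 0
  ε := 0
  d_equiv _ _ _ := rfl
  ε_equiv _ _ := rfl
  relProj _ := ⟨0, fun _ _ => (map_zero _).symm, fun _ => rfl⟩
  exact_zero _ := ⟨fun _ => ⟨0, rfl⟩, fun _ => rfl⟩
  exact_succ _ _ := ⟨fun _ => ⟨0, rfl⟩, fun _ => rfl⟩
  split _ _ := ⟨0, fun _ => 0, fun _ _ _ => rfl, fun _ _ _ _ => rfl, fun _ => rfl, fun _ => rfl,
    fun _ _ => rfl⟩

/-- The trivial extension `0 → V → V`. -/
def RelSplit.refl {V : Type u} [AddCommGroup V] (ρ : AddRep G V) :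
    RelSplit Δ (1 : AddRep G PUnit.{u + 1}) ρ ρ where
  i := 0
  p := AddMonoidHom.id V
  t _ := AddMonoidHom.id V
  u _ := 0
  i_equiv g _ := (map_zero (ρ g)).symm
  p_equiv _ _ := rfl
  t_equiv _ _ _ := rfl
  u_equiv _ _ _ := rfl
  p_i _ := rfl
  u_i _ _ := rfl
  p_t _ _ := rfl
  add _ x := zero_add x

/-- Iterated splicing; the recursion ends with `V` itself in degree zero, followed by zeros. -/
theorem RelDimLE.exists_addResolution (hΔ : DetectsFiniteSubgroups G Δ) (n : ℕ) :
    ∀ {V : Type u} [AddCommGroup V] {ρ : AddRep G V}, RelDimLE Δ n V ρ →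
      ∃ R : AddResolution Δ ρ, ∀ m, n < m → Subsingleton (R.P m) := by
  induction n with
  | zero =>
    intro V _ ρ h
    refine ⟨(RelSplit.refl ρ).splice hΔ h AddResolution.zero, fun m hm => ?_⟩
    obtain ⟨m, rfl⟩ := Nat.exists_eq_succ_of_ne_zero hm.ne'
    exact inferInstanceAs (Subsingleton PUnit)
  | succ n ih =>
    intro V _ ρ h
    obtain ⟨K, P, _, _, κ, π, hP, ⟨T⟩, hK⟩ := h
    obtain ⟨R, hR⟩ := ih hK
    refine ⟨T.splice hΔ hP R, fun m hm => ?_⟩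
    obtain ⟨m, rfl⟩ := Nat.exists_eq_succ_of_ne_zero (Nat.ne_zero_of_lt hm)
    exact hR m (Nat.succ_lt_succ_iff.1 hm)

/-- A finite resolution in the sense of `RelResolution` bounds the relative dimension. -/
theorem HasRelResolutionOfLengthLE.relDimLE {n : ℕ} (h : HasRelResolutionOfLengthLE G n) :
    RelDimLE (FinSub G) n (ULift.{u} ℤ) (1 : AddRep G (ULift.{u} ℤ)) := by
  obtain ⟨Δ, _, hΔ, R, hR⟩ := h
  -- Only relative projectivity refers to `Δ`, and it is pushed forward along `f`.
  obtain ⟨f, hf⟩ := FinSub.detectsFiniteSubgroups.exists_equivariant hΔ.finite_stabilizer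
  let _ := R.addCommGroup
  let A : AddResolution (FinSub G) (1 : AddRep G (ULift.{u} ℤ)) :=
    { P := R.P
      σ := fun n => (R.ρ n).toAddRep
      d := fun n => (R.d n).toLinearMap.toAddMonoidHom
      ε := (AddEquiv.ulift : ULift.{u} ℤ ≃+ ℤ).symm.toAddMonoidHom.comp R.ε.toLinearMap.toAddMonoidHom
      d_equiv := fun n g x => (R.d n).isIntertwining _ _ g x
      ε_equiv := fun g x => congrArg ULift.up (R.ε.isIntertwining _ _ g x)
      relProj := fun n => (R.relProjective n).relProj.map f hf (AddMonoidHom.id _)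
        (fun _ _ => rfl) (AddMonoidHom.id _) (fun _ _ => rfl) fun _ => rfl
      exact_zero := fun x => ULift.ext_iff.trans (R.exact_zero x)
      exact_succ := R.exact_succ
      split := fun S hS => by
        obtain ⟨s₀, s, hε, hd0, hd⟩ := R.split S hS
        exact ⟨s₀.toLinearMap.toAddMonoidHom.comp (AddEquiv.ulift : ULift.{u} ℤ ≃+ ℤ).toAddMonoidHom,
          fun n => (s n).toLinearMap.toAddMonoidHom,
          fun g hg x => s₀.isIntertwining _ _ ⟨g, hg⟩ x.down,
          fun g hg n x => (s n).isIntertwining _ _ ⟨g, hg⟩ x,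
          fun x => ULift.ext _ _ (hε x.down), hd0, hd⟩ }
  exact A.relDimLE FinSub.finite_stabilizer n hR

theorem RelDimLE.hasRelResolutionOfLengthLE {n : ℕ}
    (h : RelDimLE (FinSub G) n (ULift.{u} ℤ) (1 : AddRep G (ULift.{u} ℤ))) :
    HasRelResolutionOfLengthLE G n := by
  obtain ⟨A, hA⟩ := h.exists_addResolution FinSub.detectsFiniteSubgroups
  refine ⟨FinSub G, inferInstance, FinSub.detectsFiniteSubgroups,
    { P := A.P
      ρ := fun n => (A.σ n).toRepresentation
      d := fun n => ⟨(A.d n).intLinear, fun g => LinearMap.ext fun x => A.d_equiv n g x⟩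
      ε := ⟨((AddEquiv.ulift : ULift.{u} ℤ ≃+ ℤ).toAddMonoidHom.comp A.ε).intLinear,
        fun g => LinearMap.ext fun x => congrArg ULift.down (A.ε_equiv g x)⟩
      relProjective := fun n => (A.relProj n).isRelProjective
      surjective_ε := fun k => by
        obtain ⟨s₀, -, -, -, hε, -⟩ := A.split ⊥ inferInstance
        exact ⟨s₀ ⟨k⟩, congrArg ULift.down (hε ⟨k⟩)⟩
      exact_zero := fun x => ULift.ext_iff.symm.trans (A.exact_zero x)
      exact_succ := A.exact_succ
      split := fun S hS => by
        obtain ⟨s₀, s, h0, hs, hε, hd0, hd⟩ := A.split S hS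
        exact ⟨⟨(s₀.comp (AddEquiv.ulift : ULift.{u} ℤ ≃+ ℤ).symm.toAddMonoidHom).intLinear,
            fun g => LinearMap.ext fun x => h0 g.1 g.2 ⟨x⟩⟩,
          fun n => ⟨(s n).intLinear, fun g => LinearMap.ext fun x => hs g.1 g.2 n x⟩,
          fun k => congrArg ULift.down (hε ⟨k⟩), hd0, hd⟩ }, hA⟩

end Resolution

/-! ### Restriction of models to subgroups -/

/-- A finite-dimensional model for a group restricts to models of at most the same dimension for
all groups that embed into it. -/
theorem AdmitsFiniteDimensionalModel.exists_dim {G : Type u} [Group G]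
    (h : AdmitsFiniteDimensionalModel G) : ∃ d : ℕ, ∀ (H : Type u) [Group H] (φ : H →* G),
      Function.Injective φ → HasModelOfDimLE H d := by
  obtain ⟨X, _, _, _, hX, hfd⟩ := h
  obtain ⟨d, hd⟩ := Filter.eventually_atTop.1 hfd.eventually_isEmpty_cell
  refine ⟨d, fun H _ φ hφ => ⟨X, inferInstance, MulAction.compHom X φ, inferInstance, ?_,
    fun m hm => hd m hm.le⟩⟩
  let _ : MulAction H X := MulAction.compHom X φ
  have hfix : ∀ K : Subgroup H,
      MulAction.fixedPoints K X = MulAction.fixedPoints (K.map φ) X := fun K => by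
    ext x
    refine ⟨?_, fun hx k => hx ⟨φ k, k, k.2, rfl⟩⟩
    rintro hx ⟨_, k, hk, rfl⟩
    exact hx ⟨k, hk⟩
  have hfin : ∀ K : Subgroup H, Finite (K.map φ) ↔ Finite K := fun K =>
    (K.equivMapOfInjective φ hφ).toEquiv.finite_iff.symm
  exact
    { t2 := hX.t2
      continuous_smul := fun g => hX.continuous_smul (φ g)
      permutes := fun g => hX.permutes (φ g)
      admissible := fun g => hX.admissible (φ g)
      contractible := fun K hK => by
        rw [hfix]
        exact hX.contractible _ ((hfin K).2 hK)
      empty := fun K hK => by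
        rw [hfix]
        exact hX.empty _ fun h => hK ((hfin K).1 h) }

/-! ### Dimensions -/

/-- The lengths allowed are upward closed, so failure at `n` would force the infimum to be at least
`n + 1`. -/
theorem exists_hasRelResolutionOfLengthLE {G : Type u} [Group G] {n : ℕ}
    (h : relCohomologicalDim G = n) : HasRelResolutionOfLengthLE G n := by
  by_contra hn
  have hmono : ∀ m, HasRelResolutionOfLengthLE G m → n < m := fun m hm => by
    by_contra hlt
    obtain ⟨Δ, i, hΔ, R, hR⟩ := hm
    exact hn ⟨Δ, i, hΔ, R, fun k hk => hR k (by omega)⟩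
  have : ((n + 1 : ℕ) : ℕ∞) ≤ relCohomologicalDim G :=
    le_iInf₂ fun m hm => Nat.cast_le.2 (hmono m hm)
  rw [h, Nat.cast_le] at this
  omega

theorem HasRelResolutionOfLengthLE.mono {G : Type u} [Group G] {m n : ℕ}
    (h : HasRelResolutionOfLengthLE G m) (hmn : m ≤ n) : HasRelResolutionOfLengthLE G n := by
  obtain ⟨Δ, i, hΔ, R, hR⟩ := h
  exact ⟨Δ, i, hΔ, R, fun k hk => hR k (hmn.trans_lt hk)⟩

/-- Free products of groups with relative cohomological dimension at most `n` have relative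
cohomological dimension at most `n + 1`. -/
theorem HasRelResolutionOfLengthLE.coprodI {ι : Type} {H : ι → Type u} [∀ k, Group (H k)] {n : ℕ}
    (h : ∀ k, HasRelResolutionOfLengthLE (H k) n) :
    HasRelResolutionOfLengthLE (Monoid.CoprodI H) (n + 1) :=
  -- The bound is first weakened to `n + 1`, because the passage to the cokernel needs positive
  -- dimension.
  (RelDimLE.coprodI fun k => ((h k).mono n.le_succ).relDimLE).hasRelResolutionOfLengthLE

theorem mainTheorem10
    (nucinkisConjecture : ∀ (G : Type u) [Group G],
      relCohomologicalDim G < ⊤ → AdmitsFiniteDimensionalModel G) :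
    ∃ φ : ℕ → ℕ, ∀ (G : Type u) [Group G] (n : ℕ),
      relCohomologicalDim G = (n : ℕ∞) → bredonGeometricDim G ≤ (φ n : ℕ∞) := by
  have key : ∀ n : ℕ, ∃ m : ℕ, ∀ (G : Type u) [Group G],
      relCohomologicalDim G = (n : ℕ∞) → bredonGeometricDim G ≤ (m : ℕ∞) := by
    intro n
    by_contra! hcon
    choose H _ hcd hgd using hcon
    have hG : relCohomologicalDim (Monoid.CoprodI H) < ⊤ :=
      (iInf₂_le (n + 1) (HasRelResolutionOfLengthLE.coprodI fun k =>
        exists_hasRelResolutionOfLengthLE (hcd k))).trans_lt (ENat.natCast_lt_top _)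
    obtain ⟨d, hd⟩ := (nucinkisConjecture _ hG).exists_dim
    -- The diagonal step: `d` comes from the whole free product, and the factor indexed by `d` was
    -- chosen to have no model of dimension at most `d`.
    exact (hgd d).not_ge (iInf₂_le d (hd (H d) (factor H d) (factor_injective d)))
  choose φ hφ using key
  exact ⟨φ, fun G _ n h => hφ n G h⟩
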